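/- Let $b>0$ and $\alpha<1$ be real, and let $\nu\in\mathbb C$ with $\nu\neq\pm\lambda/2$ for all $\lambda=0,1,2,\dots$. Put $d=\frac1{1-\alpha}$ and $z=\frac{(1-\alpha)b^2}{4}$, and let ${}_1F_2(a;b_1,b_2;z)=\sum_{r\ge 0}\frac{(a)_r}{(b_1)_r(b_2)_r}\frac{z^r}{r!}$ with $(x)_r=x(x+1)\cdots(x+r-1)$, where $1/\Gamma$ is read as an entire function (so $1/\Gamma=0$ at the poles of $\Gamma$). Then the integral and the three series below converge absolutely, and $$\int_0^d x^\nu[1-(1-\alpha)x]^{\frac1{1-\alpha}}e^{-bx^{-1/2}}\,dx=\frac{\Gamma(1+d)}{\sqrt\pi\,(1-\alpha)^{\nu+1}}\,(R_1+R_2+R_3),$$ where $$R_1=\frac{\sqrt\pi\,\Gamma(1+\nu)}{\Gamma(2+\nu+d)}\;{}_1F_2\!\left(-1-\nu-d;\tfrac12,-\nu;z\right),$$ $$R_2=-\frac{2\sqrt\pi\,\Gamma(\frac12+\nu)}{\Gamma(\frac32+\nu+d)}\,z^{1/2}\;{}_1F_2\!\left(-\tfrac12-\nu-d;\tfrac32,\tfrac12-\nu;z\right),$$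 $$R_3=\frac{\Gamma(-\nu-1)\,\Gamma(-\nu-\frac12)}{\Gamma(1+d)}\,z^{1+\nu}\;{}_1F_2\!\left(-d;2+\nu,\tfrac32+\nu;z\right).$$ Moreover, for every real $c>\max(0,-1-\Re\nu)$ the integral on the left also equals the absolutely convergent Mellin–Barnes integral (a $G^{3,0}_{1,3}$-function) $$\frac{\Gamma(1+d)}{\sqrt\pi\,(1-\alpha)^{\nu+1}}\;\frac1{2\pi i}\int_{c-i\infty}^{c+i\infty}\frac{\Gamma(s)\,\Gamma(s+\frac12)\,\Gamma(1+\nu+s)}{\Gamma(2+\nu+d+s)}\,z^{-s}\,ds ,$$ whose integrand is analytic except for at most simple poles at $s=-r$, $s=-\frac12-r$, $s=-\nu-1-r$ $(r=0,1,2,\dots)$; the residue of the integrand at these three points is the $r$-th term (prefactor included) of the series $R_1$, $R_2$, $R_3$, respectively. -/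

import Mathlib

noncomputable section

/-- The `r`-th term `(a)_r / ((b₁)_r (b₂)_r) * z ^ r / r!` of the series `₁F₂(a; b₁, b₂; z)`,
where `(x)_r = x (x + 1) ⋯ (x + r - 1)` is the Pochhammer symbol. -/
def oneFTwoTerm (a b₁ b₂ z : ℂ) (r : ℕ) : ℂ :=
  (ascPochhammer ℂ r).eval a / ((ascPochhammer ℂ r).eval b₁ * (ascPochhammer ℂ r).eval b₂)
    * z ^ r / (r.factorial : ℂ)

/-- The generalized hypergeometric function `₁F₂(a; b₁, b₂; z)` (meaningful when neither `b₁` nor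
`b₂` is a nonpositive integer). -/
def oneFTwo (a b₁ b₂ z : ℂ) : ℂ := ∑' r : ℕ, oneFTwoTerm a b₁ b₂ z r

/-- The integrand in the Mellin–Barnes integral of Meijer's function `G^{m,n}_{p,q}(z)`. The upper
parameters are `a = [a₁, …, a_n]` followed by `a' = [a_{n+1}, …, a_p]`, the lower parameters are
`b = [b₁, …, b_m]` followed by `b' = [b_{m+1}, …, b_q]`:
`∏ Γ(b_j + s) ∏ Γ(1 - a_j - s) / (∏ Γ(1 - b'_j - s) ∏ Γ(a'_j + s)) * z ^ (-s)`.
`Complex.Gamma` takes the value `0` at its poles, so dividing by it is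
multiplying by the entire function `1 / Γ`. -/
def meijerGIntegrand (a a' b b' : List ℂ) (z s : ℂ) : ℂ :=
  ((b.map fun x => Complex.Gamma (x + s)).prod * (a.map fun x => Complex.Gamma (1 - x - s)).prod)
    / ((b'.map fun x => Complex.Gamma (1 - x - s)).prod
        * (a'.map fun x => Complex.Gamma (x + s)).prod)
    * z ^ (-s)

/-- `(1 / (2πi)) ∫_{c - i∞}^{c + i∞} f(s) ds`, with `s = c + i t`, `ds = i dt`. -/
def verticalLineIntegral (f : ℂ → ℂ) (c : ℝ) : ℂ :=
  1 / (2 * (Real.pi : ℂ) * Complex.I) * ∫ t : ℝ, f ((c : ℂ) + (t : ℂ) * Complex.I) * Complex.I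

/-- `f` has at `s₀` an isolated singularity which is at most a simple pole, with residue `ρ`: near
`s₀`, `f(s) = ρ / (s - s₀) + (analytic function)`. -/
def HasSimplePoleResidue (f : ℂ → ℂ) (s₀ ρ : ℂ) : Prop :=
  ∃ g : ℂ → ℂ, AnalyticAt ℂ g s₀ ∧
    ∀ᶠ s in nhdsWithin s₀ {s₀}ᶜ, f s = ρ / (s - s₀) + g s

/-- The integrand `x ^ ν [1 - (1 - α) x] ^ (1 / (1 - α)) exp(-b x ^ (-1/2))`
of the cut-off integral. -/
def cutoffIntegrand (ν : ℂ) (α b x : ℝ) : ℂ :=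
  (x : ℂ) ^ ν * (((1 - (1 - α) * x) ^ (1 / (1 - α)) * Real.exp (-b * x ^ (-(1 / 2 : ℝ))) : ℝ) : ℂ)

end

open Complex Filter Topology MeasureTheory Set

/-! With `x = d y` and `w = 2√z` the integral becomes a constant times `∫₀¹ y^ν (1-y)^d exp(-w
y^(-1/2)) dy`. The evaluation is a double expansion; no contour is shifted. Since `d > 0`, the
binomial series of `(1-y)^d` has absolutely summable coefficients `c_k` and may be integrated
termwise. Under `u = y^(-1/2)` each term is an upper incomplete Gamma integral: a complete Gamma
term in `w^(2(ν+1+k))` minus an exponential series integrated termwise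
(`integral_Ioi_one_cpow_mul_exp`). The Gamma terms give `R₃` by the duplication formula. The rest is
a double series in `k, n` with denominators `ν+1+k-n/2`, bounded away from `0` because `2ν` is not
an integer. Summing over `k` first gives a continued Beta function (`tsum_oneSubRpowCoeff_div`);
even `n` then yield `R₁`, odd `n` yield `R₂`. The Mellin–Barnes formula is Mellin inversion for
`exp(-2√x)` at `x = z/y`, followed by Fubini and a Beta integral in `y`. The residues come from the
local form of `Γ` at its poles and are matched with the series term by term. -/

/-- The ratio of consecutive terms of the series `₁F₂`. -/
theorem oneFTwoTerm_succ (a b₁ b₂ z : ℂ) (r : ℕ) :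
    oneFTwoTerm a b₁ b₂ z (r + 1) =
      (a + r) / (b₁ + r) * (z / ((b₂ + r) * (r + 1))) * oneFTwoTerm a b₁ b₂ z r := by
  simp only [oneFTwoTerm, ascPochhammer_succ_eval, Nat.factorial_succ, pow_succ]
  push_cast
  simp only [div_eq_mul_inv, mul_inv]
  ring

/-! ### Convergence of `₁F₂`. -/

theorem tendsto_add_natCast_cobounded (a : ℂ) :
    Tendsto (fun r : ℕ => a + (r : ℂ)) atTop (Bornology.cobounded ℂ) := by
  rw [← tendsto_norm_atTop_iff_cobounded]
  refine tendsto_atTop_mono (f := fun r : ℕ => (r : ℝ) - ‖a‖) (fun r => ?_)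
    (tendsto_atTop_add_const_right _ _ tendsto_natCast_atTop_atTop)
  have := norm_sub_norm_le (r : ℂ) (-a)
  rw [norm_natCast, norm_neg, sub_neg_eq_add, add_comm] at this
  linarith

theorem tendsto_add_natCast_div (a b : ℂ) :
    Tendsto (fun r : ℕ => (a + (r : ℂ)) / (b + r)) atTop (𝓝 1) := by
  have h : Tendsto (fun r : ℕ => 1 + (a - b) * (b + (r : ℂ))⁻¹) atTop (𝓝 (1 + (a - b) * 0)) :=
    tendsto_const_nhds.add (tendsto_const_nhds.mul
      (tendsto_inv₀_cobounded.comp (tendsto_add_natCast_cobounded b)))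
  rw [mul_zero, add_zero] at h
  refine h.congr' ?_
  have h0 : ∀ᶠ r : ℕ in atTop, b + (r : ℂ) ≠ 0 :=
    (tendsto_add_natCast_cobounded b).eventually (Bornology.eventually_ne_cobounded 0)
  filter_upwards [h0] with r hr
  field_simp
  ring

/-- Ratio test: the ratio tends to `0`. Only large `r` matters, and the recurrence survives division
by `0`, so no parameter has to be excluded. -/
theorem summable_oneFTwoTerm (a b₁ b₂ z : ℂ) : Summable (oneFTwoTerm a b₁ b₂ z) := by
  have h : Tendsto (fun r : ℕ => (a + (r : ℂ)) / (b₁ + r) * (z / ((b₂ + r) * (r + 1))))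
      atTop (𝓝 (1 * (z * (0 * 0)))) := by
    refine (tendsto_add_natCast_div a b₁).mul ?_
    simp only [div_eq_mul_inv, mul_inv]
    refine tendsto_const_nhds.mul (Tendsto.mul ?_ ?_)
    · exact tendsto_inv₀_cobounded.comp (tendsto_add_natCast_cobounded b₂)
    · simpa [add_comm, Function.comp_def] using
        tendsto_inv₀_cobounded.comp (tendsto_add_natCast_cobounded 1)
  have h' := h.norm
  simp only [mul_zero, norm_zero] at h'
  refine summable_of_ratio_norm_eventually_le (r := 1 / 2) (by norm_num) ?_
  filter_upwards [h'.eventually_le_const (show (0 : ℝ) < 1 / 2 by norm_num)] with r hr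
  rw [oneFTwoTerm_succ, norm_mul]
  gcongr

/-! ### Gamma at arguments shifted by `-r`, and the terms of `₁F₂`. -/

theorem Gamma_sub_natCast {a : ℂ} (ha : ∀ k : ℕ, a ≠ k + 1) (r : ℕ) :
    Gamma (a - r) = (-1) ^ r * Gamma a / (ascPochhammer ℂ r).eval (1 - a) := by
  induction r with
  | zero => simp
  | succ r ih =>
    have h0 : a - (r + 1) ≠ 0 := sub_ne_zero.2 (ha r)
    have h1 : Gamma (a - r) = (a - (r + 1)) * Gamma (a - (r + 1)) := by
      rw [← Gamma_add_one _ h0]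
      ring_nf
    rw [ascPochhammer_succ_eval, pow_succ, show 1 - a + (r : ℂ) = -(a - (r + 1)) by ring]
    have h2 : Gamma (a - (r + 1)) = Gamma (a - r) / (a - (r + 1)) := by
      rw [h1]
      field_simp
    push_cast
    rw [h2, ih]
    simp only [div_eq_mul_inv, mul_inv, inv_neg]
    ring

/-- The functional equation of the entire function `1/Γ` holds everywhere, hence no condition on
`a`. -/
theorem inv_Gamma_sub_natCast (a : ℂ) (r : ℕ) :
    (Gamma (a - r))⁻¹ = (-1) ^ r * (ascPochhammer ℂ r).eval (1 - a) * (Gamma a)⁻¹ := by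
  induction r with
  | zero => simp
  | succ r ih =>
    rw [one_div_Gamma_eq_self_mul_one_div_Gamma_add_one, ascPochhammer_succ_eval, pow_succ]
    push_cast
    rw [show a - ((r : ℂ) + 1) + 1 = a - r by ring, ih]
    ring

/-- The right side has the shape of a residue at the `r`-th pole of a Gamma factor; this is the
bridge from residues to series terms. -/
theorem Gamma_div_mul_oneFTwoTerm {p q : ℂ} (hp : ∀ k : ℕ, p ≠ k + 1) (hq : ∀ k : ℕ, q ≠ k + 1)
    (t z : ℂ) (r : ℕ) :
    Gamma p * Gamma q / Gamma t * oneFTwoTerm (1 - t) (1 - p) (1 - q) z r =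
      (-1) ^ r / (r.factorial : ℂ) * (Gamma (p - r) * Gamma (q - r) / Gamma (t - r) * z ^ r) := by
  rw [Gamma_sub_natCast hp, Gamma_sub_natCast hq, div_eq_mul_inv _ (Gamma (t - r)),
    inv_Gamma_sub_natCast, oneFTwoTerm]
  have h : ((-1 : ℂ) ^ r) * (-1) ^ r = 1 := by rw [← mul_pow]; simp
  simp only [div_eq_mul_inv, mul_inv]
  -- With `ε = (-1)^r` the right side carries `ε⁴`, and `ε⁴ - 1 = (ε² + 1)(ε² - 1)`.
  linear_combination (-(Gamma p * Gamma q * (Gamma t)⁻¹ * (ascPochhammer ℂ r).eval (1 - t)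
    * ((ascPochhammer ℂ r).eval (1 - p))⁻¹ * ((ascPochhammer ℂ r).eval (1 - q))⁻¹ * z ^ r
    * (r.factorial : ℂ)⁻¹)) * (((-1 : ℂ) ^ r) * (-1) ^ r + 1) * h

/-! ### Poles and residues of Gamma. -/

theorem analyticAt_Gamma {s : ℂ} (hs : ∀ m : ℕ, s ≠ -m) : AnalyticAt ℂ Gamma s := by
  have h := (differentiable_one_div_Gamma.analyticAt s).inv (inv_ne_zero (Gamma_ne_zero hs))
  have e : (fun s : ℂ => (Gamma s)⁻¹)⁻¹ = Gamma := by ext; simp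
  rwa [e] at h

/-- `Γ(s) = Γ(s+1)/s` carries the local form from the pole `-r` to `-(r+1)`. -/
theorem exists_Gamma_eq_analytic_div (r : ℕ) :
    ∃ φ : ℂ → ℂ, AnalyticAt ℂ φ (-r) ∧ φ (-r) = (-1) ^ r / (r.factorial : ℂ) ∧
      ∀ᶠ s in 𝓝[≠] (-r : ℂ), Gamma s = φ s / (s + r) := by
  induction r with
  | zero =>
    refine ⟨fun s => Gamma (s + 1), ?_, by simp, ?_⟩
    · refine AnalyticAt.fun_comp (analyticAt_Gamma fun m h => ?_) (by fun_prop)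
      have : ((m + 1 : ℕ) : ℂ) = 0 := by push_cast; simp at h; linear_combination h
      exact Nat.cast_ne_zero.2 m.succ_ne_zero this
    · filter_upwards [self_mem_nhdsWithin] with s hs
      have hs : s ≠ 0 := by simpa using hs
      rw [Gamma_add_one s hs]
      simp [hs]
  | succ r ih =>
    obtain ⟨φ, h1, h2, h3⟩ := ih
    have e : -((r + 1 : ℕ) : ℂ) + 1 = -r := by push_cast; ring
    have hr : -((r + 1 : ℕ) : ℂ) ≠ 0 := neg_ne_zero.2 (Nat.cast_ne_zero.2 r.succ_ne_zero)
    refine ⟨fun s => φ (s + 1) / s, ?_, ?_, ?_⟩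
    · refine AnalyticAt.div (AnalyticAt.fun_comp (by rwa [e]) (by fun_prop)) (by fun_prop) hr
    · simp only [e, h2, Nat.factorial_succ, pow_succ]
      push_cast
      have : (r : ℂ) + 1 ≠ 0 := by exact_mod_cast r.succ_ne_zero
      have : (r.factorial : ℂ) ≠ 0 := by exact_mod_cast r.factorial_ne_zero
      field_simp
    · have ht : Tendsto (fun s : ℂ => s + 1) (𝓝[≠] (-((r + 1 : ℕ) : ℂ))) (𝓝[≠] (-(r : ℂ))) := by
        refine tendsto_nhdsWithin_iff.2 ⟨?_, ?_⟩
        · rw [← e]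
          exact ((continuous_id.add continuous_const).tendsto _).mono_left nhdsWithin_le_nhds
        · filter_upwards [self_mem_nhdsWithin] with s hs h
          exact hs (by simp only [Set.mem_singleton_iff] at h ⊢; linear_combination h - e)
      have hne : ∀ᶠ s in 𝓝[≠] (-((r + 1 : ℕ) : ℂ)), s ≠ 0 :=
        eventually_nhdsWithin_of_eventually_nhds (eventually_ne_nhds hr)
      filter_upwards [ht.eventually h3, hne] with s hs h0
      have h4 : Gamma s = Gamma (s + 1) / s := by
        rw [Gamma_add_one s h0]
        field_simp
      rw [h4, hs]
      push_cast
      rw [div_right_comm, add_assoc, add_comm (1 : ℂ)]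

/-- The residue of `Γ (u + s) h (s)` at the `r`-th pole of `Γ (u + s)`. -/
theorem hasSimplePoleResidue_Gamma_mul {f h : ℂ → ℂ} {u s₀ : ℂ} (r : ℕ) (hs₀ : s₀ = -u - r)
    (hf : ∀ s, f s = Gamma (u + s) * h s) (hh : AnalyticAt ℂ h s₀) :
    HasSimplePoleResidue f s₀ ((-1) ^ r / (r.factorial : ℂ) * h s₀) := by
  obtain ⟨φ, h1, h2, h3⟩ := exists_Gamma_eq_analytic_div r
  have e : u + s₀ = -r := by rw [hs₀]; ring
  set ψ : ℂ → ℂ := fun s => φ (u + s) * h s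
  have hψ : AnalyticAt ℂ ψ s₀ :=
    (AnalyticAt.fun_comp (by rwa [e]) (by fun_prop)).mul hh
  have hψ0 : ψ s₀ = (-1) ^ r / (r.factorial : ℂ) * h s₀ := by simp only [ψ, e, h2]
  -- `ψ(s)/(s-s₀)` is `ψ(s₀)/(s-s₀)` plus the difference quotient of `ψ`, which extends analytically
  -- to `s₀`.
  refine ⟨dslope ψ s₀, ?_, ?_⟩
  · obtain ⟨p, hp⟩ := hψ
    exact ⟨_, hp.has_fpower_series_dslope_fslope⟩
  · have ht : Tendsto (fun s : ℂ => u + s) (𝓝[≠] s₀) (𝓝[≠] (-(r : ℂ))) := by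
      refine tendsto_nhdsWithin_iff.2 ⟨?_, ?_⟩
      · rw [← e]
        exact ((continuous_const.add continuous_id).tendsto _).mono_left nhdsWithin_le_nhds
      · filter_upwards [self_mem_nhdsWithin] with s hs h
        exact hs (by simp only [Set.mem_singleton_iff] at h ⊢; linear_combination h - e)
    filter_upwards [ht.eventually h3, self_mem_nhdsWithin] with s hs hne
    have hne' : s - s₀ ≠ 0 := sub_ne_zero.2 hne
    rw [hf, hs, dslope_of_ne _ hne, slope_def_field, ← hψ0,
      show u + s + r = s - s₀ by linear_combination e]
    simp only [ψ]
    field_simp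
    ring

/-! ### The binomial series of `(1-y)^d`. -/

/-- The coefficient `(-d)_k / k!` of `y ^ k` in the binomial series of `(1 - y) ^ d`. -/
noncomputable def oneSubRpowCoeff (d : ℝ) (k : ℕ) : ℝ :=
  (ascPochhammer ℝ k).eval (-d) / (k.factorial : ℝ)

theorem oneSubRpowCoeff_succ (d : ℝ) (k : ℕ) :
    ((k : ℝ) + 1) * oneSubRpowCoeff d (k + 1) = (k - d) * oneSubRpowCoeff d k := by
  have : (k : ℝ) + 1 ≠ 0 := by positivity
  have : (k.factorial : ℝ) ≠ 0 := by positivity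
  simp only [oneSubRpowCoeff, ascPochhammer_succ_eval, Nat.factorial_succ]
  push_cast
  field_simp
  ring

theorem hasSum_oneSubRpowCoeff (d : ℝ) {y : ℝ} (hy : |y| < 1) :
    HasSum (fun k => oneSubRpowCoeff d k * y ^ k) ((1 - y) ^ d) := by
  have h := (Real.one_div_one_sub_rpow_hasFPowerSeriesOnBall_zero (-d)).hasSum (y := y)
    (by simpa [enorm_eq_nnnorm, ← NNReal.coe_lt_coe] using hy)
  have h1 : 1 / (1 - (0 + y)) ^ (-d) = (1 - y) ^ d := by
    rw [zero_add, Real.rpow_neg (by linarith [le_abs_self y]), one_div, inv_inv]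
  rw [h1] at h
  refine h.congr_fun fun k => ?_
  have h2 := Ring.factorial_nsmul_multichoose_eq_ascPochhammer (-d) k
  have : (k.factorial : ℝ) ≠ 0 := by positivity
  rw [nsmul_eq_mul, Polynomial.ascPochhammer_smeval_eq_eval] at h2
  -- `Ring.choose x k` unfolds to `Ring.multichoose (x - k + 1) k`.
  have h3 : Ring.choose (-d + k - 1) k = Ring.multichoose (-d) k :=
    congrArg (fun t => Ring.multichoose t k) (by ring)
  rw [oneSubRpowCoeff, ← h2, FormalMultilinearSeries.ofScalars_apply_eq, h3]
  simp [this, mul_comm]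

/-- For `k ≥ d` the recurrence reads `d|c_k| = k|c_k| - (k+1)|c_{k+1}|`, so the partial sums
telescope and stay bounded. -/
theorem summable_abs_oneSubRpowCoeff {d : ℝ} (hd : 0 < d) :
    Summable fun k => |oneSubRpowCoeff d k| := by
  obtain ⟨N, hN⟩ := exists_nat_ge d
  rw [← summable_nat_add_iff N]
  have key : ∀ n, ∑ i ∈ Finset.range n, |oneSubRpowCoeff d (i + N)| =
      (N * |oneSubRpowCoeff d N| - (n + N : ℕ) * |oneSubRpowCoeff d (n + N)|) / d := by
    intro n
    induction n with
    | zero => simp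
    | succ n ih =>
      have h := congrArg abs (oneSubRpowCoeff_succ d (n + N))
      have h1 : (0 : ℝ) ≤ (n + N : ℕ) - d := by
        push_cast; linarith [(Nat.cast_nonneg n : (0 : ℝ) ≤ n)]
      rw [abs_mul, abs_mul, abs_of_nonneg h1,
        abs_of_nonneg (by positivity : (0 : ℝ) ≤ (n + N : ℕ) + 1)] at h
      rw [Finset.sum_range_succ, ih, show n + 1 + N = n + N + 1 by ring]
      push_cast at h ⊢
      field_simp
      linear_combination h
  refine summable_of_sum_range_le (c := N * |oneSubRpowCoeff d N| / d) (fun _ => abs_nonneg _)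
    fun n => ?_
  rw [key]
  gcongr
  have : (0 : ℝ) ≤ (n + N : ℕ) * |oneSubRpowCoeff d (n + N)| := by positivity
  linarith

/-! ### Distances to the integers and termwise integration. -/

/-- Complex numbers outside `ℤ` keep a positive distance from `ℤ`. -/
theorem exists_pos_le_norm_add_intCast {u : ℂ} (hu : ∀ m : ℤ, u + m ≠ 0) :
    ∃ δ : ℝ, 0 < δ ∧ ∀ m : ℤ, δ ≤ ‖u + m‖ := by
  have h : u ∉ Set.range ((↑) : ℤ → ℂ) := by
    rintro ⟨m, rfl⟩
    exact hu (-m) (by simp)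
  obtain ⟨δ, hδ, hb⟩ := Metric.isOpen_iff.1 isClosed_range_intCast.isOpen_compl u h
  refine ⟨δ, hδ, fun m => ?_⟩
  by_contra! hlt
  refine hb (a := ((-m : ℤ) : ℂ)) ?_ ⟨-m, rfl⟩
  rw [Metric.mem_ball, dist_comm, dist_eq_norm]
  simpa using hlt

/-- A complex number that is not in `-ℕ` keeps a positive distance from `-ℕ`. -/
theorem exists_pos_le_norm_add_natCast {u : ℂ} (hu : ∀ m : ℕ, u + m ≠ 0) :
    ∃ δ : ℝ, 0 < δ ∧ ∀ m : ℕ, δ ≤ ‖u + m‖ := by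
  have h1 : ∀ᶠ m : ℕ in atTop, 1 ≤ ‖u + m‖ :=
    (tendsto_norm_cobounded_atTop.comp (tendsto_add_natCast_cobounded u)).eventually_ge_atTop 1
  obtain ⟨N, hN⟩ := eventually_atTop.1 h1
  obtain ⟨δ, hδ, h⟩ : ∃ δ : ℝ, 0 < δ ∧ ∀ m < N, δ ≤ ‖u + m‖ := by
    clear hN
    induction N with
    | zero => exact ⟨1, one_pos, by simp⟩
    | succ N ih =>
      obtain ⟨δ, hδ, h⟩ := ih
      refine ⟨min δ ‖u + N‖, lt_min hδ (norm_pos_iff.2 (hu N)), fun m hm => ?_⟩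
      rcases Nat.lt_succ_iff_lt_or_eq.1 hm with h' | rfl
      · exact (min_le_left _ _).trans (h m h')
      · exact min_le_right _ _
  refine ⟨min δ 1, lt_min hδ one_pos, fun m => ?_⟩
  rcases lt_or_ge m N with h' | h'
  · exact (min_le_left _ _).trans (h m h')
  · exact (min_le_right _ _).trans (hN m h')

theorem summable_div_add_natCast {c : ℕ → ℂ} (hc : Summable fun k => ‖c k‖) {u : ℂ}
    (hu : ∀ m : ℕ, u + m ≠ 0) : Summable fun k => c k / (u + k) := by
  obtain ⟨δ, hδ, h⟩ := exists_pos_le_norm_add_natCast hu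
  refine Summable.of_norm_bounded (hc.div_const δ) fun k => ?_
  rw [norm_div]
  gcongr
  exact h k

/-- On `(0,1)` the terms are dominated by `‖c k‖ ‖g y‖`, since `|y^k| ≤ 1`. It serves both the
binomial and the exponential series. -/
theorem hasSum_integral_mul_powerSeries {c : ℕ → ℂ} (hc : Summable fun k => ‖c k‖) {g F : ℝ → ℂ}
    (hg : IntegrableOn g (Ioo 0 1))
    (hF : ∀ y ∈ Ioo (0 : ℝ) 1, HasSum (fun k => c k * (y : ℂ) ^ k) (F y)) :
    HasSum (fun k => c k * ∫ y in Ioo (0 : ℝ) 1, g y * (y : ℂ) ^ k)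
      (∫ y in Ioo (0 : ℝ) 1, g y * F y) := by
  simp_rw [← integral_const_mul]
  refine hasSum_integral_of_dominated_convergence (fun k y => ‖c k‖ * ‖g y‖) (fun k => ?_)
    (fun k => ?_) (ae_of_all _ fun y => hc.mul_right _) ?_ ?_
  · exact (hg.aestronglyMeasurable.mul (by fun_prop)).const_mul _
  · filter_upwards [ae_restrict_mem measurableSet_Ioo] with y hy
    rw [norm_mul, norm_mul, norm_pow, norm_real, Real.norm_of_nonneg hy.1.le]
    gcongr
    exact mul_le_of_le_one_right (norm_nonneg _) (pow_le_one₀ hy.1.le hy.2.le)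
  · simp_rw [tsum_mul_right]
    exact hg.norm.const_mul _
  · filter_upwards [ae_restrict_mem measurableSet_Ioo] with y hy
    exact ((hF y hy).mul_left (g y)).congr_fun fun k => by ring

theorem integrableOn_cpow_Ioo {s : ℂ} (hs : 0 < s.re) :
    IntegrableOn (fun y : ℝ => (y : ℂ) ^ (s - 1)) (Ioo 0 1) := by
  rw [← integrableOn_Ioc_iff_integrableOn_Ioo, ← intervalIntegrable_iff_integrableOn_Ioc_of_le
    zero_le_one]
  exact intervalIntegral.intervalIntegrable_cpow' (by simpa using hs)

theorem hasSum_integral_cpow_mul_powerSeries {c : ℕ → ℂ} (hc : Summable fun k => ‖c k‖)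
    {F : ℝ → ℂ} {s : ℂ} (hs : 0 < s.re)
    (hF : ∀ y ∈ Ioo (0 : ℝ) 1, HasSum (fun k => c k * (y : ℂ) ^ k) (F y)) :
    HasSum (fun k => c k / (s + k)) (∫ y in Ioo (0 : ℝ) 1, (y : ℂ) ^ (s - 1) * F y) := by
  refine (hasSum_integral_mul_powerSeries hc (integrableOn_cpow_Ioo hs) hF).congr_fun fun k => ?_
  have hk : 0 < (s + k).re := by simp; positivity
  have h1 : ∫ y in Ioo (0 : ℝ) 1, (y : ℂ) ^ (s - 1) * (y : ℂ) ^ k =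
      ∫ y in Ioo (0 : ℝ) 1, (y : ℂ) ^ (s + k - 1) := by
    refine setIntegral_congr_fun measurableSet_Ioo fun y hy => ?_
    have hy0 : (y : ℂ) ≠ 0 := ofReal_ne_zero.2 hy.1.ne'
    rw [← cpow_natCast, ← cpow_add _ _ hy0]
    congr 1
    ring
  have h0 : s + k ≠ 0 := fun h => by rw [h] at hk; simp at hk
  rw [h1, ← integral_Ioc_eq_integral_Ioo, ← intervalIntegral.integral_of_le zero_le_one,
    integral_cpow (Or.inl (by simpa using hk))]
  simp [zero_cpow h0, div_eq_mul_inv]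

/-! ### Partial fractions of the Beta function, continued to the left. -/

theorem betaIntegral_eq_Gamma_mul_div {s t : ℂ} (hs : 0 < s.re) (ht : 0 < t.re) :
    betaIntegral s t = Gamma s * Gamma t / Gamma (s + t) := by
  rw [Gamma_mul_Gamma_eq_betaIntegral hs ht, mul_div_cancel_left₀]
  exact Gamma_ne_zero_of_re_pos (by simp; linarith)

theorem hasSum_oneSubRpowCoeff_div_of_re_pos {d : ℝ} (hd : 0 < d) {s : ℂ} (hs : 0 < s.re) :
    HasSum (fun k => (oneSubRpowCoeff d k : ℂ) / (s + k))
      (Gamma s * Gamma (d + 1) / Gamma (s + d + 1)) := by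
  have h := hasSum_integral_cpow_mul_powerSeries (c := fun k => (oneSubRpowCoeff d k : ℂ))
    (by simpa using summable_abs_oneSubRpowCoeff hd) (F := fun y => ((1 - y) ^ d : ℝ)) hs ?_
  · rw [add_assoc, ← betaIntegral_eq_Gamma_mul_div hs (by simp; linarith), betaIntegral,
      intervalIntegral.integral_of_le zero_le_one, integral_Ioc_eq_integral_Ioo]
    convert h using 1
    refine setIntegral_congr_fun measurableSet_Ioo fun y hy => ?_
    rw [ofReal_cpow (by linarith [hy.2])]
    simp
  · intro y hy
    have := hasSum_oneSubRpowCoeff d (y := y) (by rw [abs_of_pos hy.1]; exact hy.2)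
    exact_mod_cast this

/-- `Γ(s)/Γ(s+d+1)` obeys the same first-order equation, so the Beta evaluation can descend from
`s+1` to `s`. -/
theorem tsum_oneSubRpowCoeff_div_recurrence {d : ℝ} (hd : 0 < d) {s : ℂ}
    (hs : ∀ m : ℕ, s + m ≠ 0) :
    s * ∑' k, (oneSubRpowCoeff d k : ℂ) / (s + k) =
      (s + 1 + d) * ∑' k, (oneSubRpowCoeff d k : ℂ) / (s + 1 + k) := by
  have hc : Summable fun k => ‖(oneSubRpowCoeff d k : ℂ)‖ := by
    simpa using summable_abs_oneSubRpowCoeff hd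
  have hs1 : ∀ m : ℕ, s + 1 + m ≠ 0 := fun m h => hs (m + 1) (by push_cast; linear_combination h)
  have h1 := summable_div_add_natCast hc hs
  have h2 := summable_div_add_natCast hc hs1
  -- `b k = k c_k/(s+k)`; as `b 0 = 0`, shifting the index and using the coefficient recurrence
  -- brings in `s+1`.
  set b : ℕ → ℂ := fun k => oneSubRpowCoeff d k - s * (oneSubRpowCoeff d k / (s + k))
  have hb : Summable b := hc.of_norm.sub (h1.mul_left s)
  have hb0 : b 0 = 0 := by
    have := hs 0
    simp only [b, Nat.cast_zero, add_zero] at this ⊢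
    field_simp
    ring
  have hb1 := hb.tsum_eq_zero_add
  rw [hb0, zero_add] at hb1
  have hb2 : ∀ k, b (k + 1) =
      oneSubRpowCoeff d k - (s + 1 + d) * (oneSubRpowCoeff d k / (s + 1 + k)) := by
    intro k
    have h3 : ((k : ℂ) + 1) * oneSubRpowCoeff d (k + 1) = (k - d) * oneSubRpowCoeff d k := by
      exact_mod_cast oneSubRpowCoeff_succ d k
    have h4 := hs1 k
    have h5 : s + (k + 1) ≠ 0 := by rwa [add_assoc, add_comm 1] at h4
    simp only [b]
    push_cast
    field_simp
    linear_combination (s + 1 + k) * h3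
  simp_rw [hb2] at hb1
  simp only [b] at hb1
  rw [hc.of_norm.tsum_sub (h1.mul_left s), hc.of_norm.tsum_sub (h2.mul_left _), tsum_mul_left,
    tsum_mul_left] at hb1
  linear_combination -hb1

/-- Continuation by induction on a bound `n > -Re s`, starting from the Beta integral for `Re s >
0`. -/
theorem tsum_oneSubRpowCoeff_div {d : ℝ} (hd : 0 < d) {s : ℂ} (hs : ∀ m : ℕ, s + m ≠ 0) :
    ∑' k, (oneSubRpowCoeff d k : ℂ) / (s + k) = Gamma s * Gamma (d + 1) / Gamma (s + d + 1) := by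
  obtain ⟨n, hn⟩ := exists_nat_gt (-s.re)
  induction n generalizing s with
  | zero =>
    exact (hasSum_oneSubRpowCoeff_div_of_re_pos hd (by simpa using hn)).tsum_eq
  | succ n ih =>
    have hs1 : ∀ m : ℕ, s + 1 + m ≠ 0 := fun m h =>
      hs (m + 1) (by push_cast; linear_combination h)
    have hs0 : s ≠ 0 := by simpa using hs 0
    have h := tsum_oneSubRpowCoeff_div_recurrence hd hs
    rw [ih hs1 (by push_cast at hn; simp; linarith), Gamma_add_one s hs0] at h
    apply mul_left_cancel₀ hs0
    rw [h, div_eq_mul_inv _ (Gamma (s + d + 1)), one_div_Gamma_eq_self_mul_one_div_Gamma_add_one,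
      show s + d + 1 + 1 = s + 1 + d + 1 by ring]
    ring

/-! ### The upper incomplete Gamma function. -/

theorem integrableOn_cpow_mul_exp_neg_mul_Ioi_one {w : ℝ} (hw : 0 < w) (s : ℂ) :
    IntegrableOn (fun u : ℝ => (u : ℂ) ^ s * Real.exp (-w * u)) (Ioi 1) := by
  have hcont : ContinuousOn (fun u : ℝ => (u : ℂ) ^ s * Real.exp (-w * u)) (Ici 1) := by
    refine ContinuousOn.mul ?_ (by fun_prop)
    exact fun u hu => (continuousAt_ofReal_cpow_const _ _
      (Or.inr (zero_lt_one.trans_le hu).ne')).continuousWithinAt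
  rw [IntegrableOn, ← integrable_norm_iff
    ((hcont.mono Ioi_subset_Ici_self).aestronglyMeasurable measurableSet_Ioi)]
  refine integrable_of_isBigO_exp_neg (half_pos hw) hcont.norm ?_
  have h := ((isLittleO_rpow_exp_pos_mul_atTop s.re (half_pos hw)).isBigO).mul
    (Asymptotics.isBigO_refl (fun u : ℝ => Real.exp (-w * u)) atTop)
  refine h.congr' ?_ ?_
  · filter_upwards [eventually_gt_atTop 0] with u hu
    rw [norm_mul, norm_cpow_eq_rpow_re_of_pos hu, norm_real, Real.norm_of_nonneg (Real.exp_nonneg _)]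
  · refine Eventually.of_forall fun u => ?_
    simp only
    rw [← Real.exp_add]
    ring_nf

theorem summable_neg_pow_div_factorial (w : ℝ) :
    Summable fun n : ℕ => ‖(-(w : ℂ)) ^ n / (n.factorial : ℂ)‖ := by
  simpa using Real.summable_pow_div_factorial |w|

theorem hasSum_neg_pow_div_factorial (w : ℝ) :
    HasSum (fun n : ℕ => (-(w : ℂ)) ^ n / (n.factorial : ℂ)) (Real.exp (-w)) := by
  have := NormedSpace.expSeries_div_hasSum_exp (-(w : ℂ))
  rw [← exp_eq_exp_ℂ] at this
  simpa using this

/-- The Gamma integral over `(0,∞)` minus its part over `(0,1)`, where `exp(-wu)` is expanded and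
integrated termwise. -/
theorem integral_Ioi_one_of_re_pos {w : ℝ} (hw : 0 < w) {s : ℂ} (hs : 0 < s.re) :
    ∫ u in Ioi (1 : ℝ), (u : ℂ) ^ (s - 1) * Real.exp (-w * u) =
      (w : ℂ) ^ (-s) * Gamma s - ∑' n : ℕ, (-(w : ℂ)) ^ n / (n.factorial : ℂ) / (s + n) := by
  have h := hasSum_integral_cpow_mul_powerSeries (summable_neg_pow_div_factorial w)
    (F := fun y => (Real.exp (-w * y) : ℝ)) hs (fun y _ => by
      have := hasSum_neg_pow_div_factorial (w * y)
      rw [← neg_mul] at this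
      refine this.congr_fun fun k => ?_
      push_cast
      rw [← neg_mul, mul_pow]
      ring)
  have h0 := integral_cpow_mul_exp_neg_mul_Ioi hs hw
  have h1 : ∫ u in Ioi (0 : ℝ), (u : ℂ) ^ (s - 1) * Real.exp (-w * u) =
      (w : ℂ) ^ (-s) * Gamma s := by
    rw [cpow_neg, ← inv_cpow _ _ (by rw [arg_ofReal_of_nonneg hw.le]; exact Real.pi_pos.ne),
      ← one_div, ← h0]
    simp
  have hi : IntegrableOn (fun u : ℝ => (u : ℂ) ^ (s - 1) * Real.exp (-w * u)) (Ioc 0 1) := by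
    rw [integrableOn_Ioc_iff_integrableOn_Ioo]
    refine Integrable.mul_bdd (c := 1) (integrableOn_cpow_Ioo hs) (by fun_prop) ?_
    filter_upwards [ae_restrict_mem measurableSet_Ioo] with y hy
    rw [norm_real, Real.norm_of_nonneg (Real.exp_nonneg _), Real.exp_le_one_iff]
    nlinarith [hy.1]
  rw [← Ioc_union_Ioi_eq_Ioi zero_le_one, setIntegral_union Ioc_disjoint_Ioi_same measurableSet_Ioi
    hi (integrableOn_cpow_mul_exp_neg_mul_Ioi_one hw _), integral_Ioc_eq_integral_Ioo] at h1
  rw [h.tsum_eq, ← h1]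
  ring

/-- Integration by parts; `tsum_neg_pow_div_recurrence` is the matching equation for the series
side. -/
theorem integral_Ioi_one_recurrence {w : ℝ} (hw : 0 < w) {s : ℂ} (hs : s ≠ 0) :
    s * ∫ u in Ioi (1 : ℝ), (u : ℂ) ^ (s - 1) * Real.exp (-w * u) =
      w * (∫ u in Ioi (1 : ℝ), (u : ℂ) ^ s * Real.exp (-w * u)) - Real.exp (-w) := by
  have hi1 := integrableOn_cpow_mul_exp_neg_mul_Ioi_one hw (s - 1)
  have hi2 := integrableOn_cpow_mul_exp_neg_mul_Ioi_one hw s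
  have hderiv : ∀ u ∈ Ici (1 : ℝ), HasDerivAt (fun u : ℝ => (u : ℂ) ^ s * Real.exp (-w * u))
      (s * ((u : ℂ) ^ (s - 1) * Real.exp (-w * u)) - w * ((u : ℂ) ^ s * Real.exp (-w * u))) u := by
    intro u hu
    have hu0 : u ≠ 0 := (zero_lt_one.trans_le hu).ne'
    have h1 : HasDerivAt (fun u : ℝ => (u : ℂ) ^ s) (s * (u : ℂ) ^ (s - 1)) u :=
      hasDerivAt_ofReal_cpow_const hu0 hs
    have h2 : HasDerivAt (fun u : ℝ => ((Real.exp (-w * u) : ℝ) : ℂ))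
        ((Real.exp (-w * u) * (-w * 1) : ℝ) : ℂ) u :=
      (((hasDerivAt_id u).const_mul (-w)).exp).ofReal_comp
    refine (h1.mul h2).congr_deriv ?_
    push_cast
    ring
  have hlim : Tendsto (fun u : ℝ => (u : ℂ) ^ s * Real.exp (-w * u)) atTop (𝓝 0) := by
    rw [tendsto_zero_iff_norm_tendsto_zero]
    refine (tendsto_rpow_mul_exp_neg_mul_atTop_nhds_zero s.re w hw).congr' ?_
    filter_upwards [eventually_gt_atTop 0] with u hu
    rw [norm_mul, norm_cpow_eq_rpow_re_of_pos hu, norm_real, Real.norm_of_nonneg (Real.exp_nonneg _)]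
  have h := integral_Ioi_of_hasDerivAt_of_tendsto' hderiv
    ((hi1.const_mul s).sub (hi2.const_mul (w : ℂ))) hlim
  rw [integral_sub (hi1.const_mul s) (hi2.const_mul (w : ℂ)), integral_const_mul,
    integral_const_mul] at h
  simp only [ofReal_one, one_cpow, mul_one, one_mul] at h
  linear_combination h

theorem tsum_neg_pow_div_recurrence (w : ℝ) {s : ℂ} (hs : ∀ m : ℕ, s + m ≠ 0) :
    s * ∑' n : ℕ, (-(w : ℂ)) ^ n / (n.factorial : ℂ) / (s + n) =
      Real.exp (-w) + w * ∑' n : ℕ, (-(w : ℂ)) ^ n / (n.factorial : ℂ) / (s + 1 + n) := by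
  have hc := summable_neg_pow_div_factorial w
  have h1 := summable_div_add_natCast hc hs
  set b : ℕ → ℂ := fun n => (-(w : ℂ)) ^ n / (n.factorial : ℂ)
    - s * ((-(w : ℂ)) ^ n / (n.factorial : ℂ) / (s + n))
  have hb : Summable b := hc.of_norm.sub (h1.mul_left s)
  have hb0 : b 0 = 0 := by
    have := hs 0
    simp only [b, Nat.cast_zero, add_zero] at this ⊢
    field_simp
    simp
  have hb1 := hb.tsum_eq_zero_add
  rw [hb0, zero_add] at hb1
  have hb2 : ∀ n, b (n + 1) = -w * ((-(w : ℂ)) ^ n / (n.factorial : ℂ) / (s + 1 + n)) := by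
    intro n
    have h5 := hs (n + 1)
    have h6 : s + 1 + n ≠ 0 := by push_cast at h5; rwa [add_assoc, add_comm 1]
    have h7 : (n : ℂ) + 1 ≠ 0 := by exact_mod_cast n.succ_ne_zero
    have h8 : (n.factorial : ℂ) ≠ 0 := by exact_mod_cast n.factorial_ne_zero
    simp only [b, Nat.factorial_succ, pow_succ]
    push_cast at h5 ⊢
    field_simp
    ring
  simp_rw [hb2] at hb1
  simp only [b] at hb1
  rw [hc.of_norm.tsum_sub (h1.mul_left s), tsum_mul_left, tsum_mul_left,
    (hasSum_neg_pow_div_factorial w).tsum_eq] at hb1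
  linear_combination -hb1

/-- The upper incomplete Gamma function, continued to all exponents `s ∉ -ℕ`. -/
theorem integral_Ioi_one_cpow_mul_exp {w : ℝ} (hw : 0 < w) {s : ℂ} (hs : ∀ m : ℕ, s + m ≠ 0) :
    ∫ u in Ioi (1 : ℝ), (u : ℂ) ^ (s - 1) * Real.exp (-w * u) =
      (w : ℂ) ^ (-s) * Gamma s - ∑' n : ℕ, (-(w : ℂ)) ^ n / (n.factorial : ℂ) / (s + n) := by
  obtain ⟨n, hn⟩ := exists_nat_gt (-s.re)
  induction n generalizing s with
  | zero => exact integral_Ioi_one_of_re_pos hw (by simpa using hn)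
  | succ n ih =>
    have hs1 : ∀ m : ℕ, s + 1 + m ≠ 0 := fun m h =>
      hs (m + 1) (by push_cast; linear_combination h)
    have hs0 : s ≠ 0 := by simpa using hs 0
    have hw0 : (w : ℂ) ≠ 0 := ofReal_ne_zero.2 hw.ne'
    have h := ih hs1 (by push_cast at hn; simp; linarith)
    rw [add_sub_cancel_right, Gamma_add_one s hs0, neg_add, cpow_add _ _ hw0, cpow_neg_one] at h
    apply mul_left_cancel₀ hs0
    rw [integral_Ioi_one_recurrence hw hs0, mul_sub, tsum_neg_pow_div_recurrence w hs, h]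
    field_simp
    ring

/-! ### The substitution `u = y^(-1/2)`. -/

theorem one_lt_rpow_neg_half_iff {y : ℝ} (hy : 0 < y) :
    1 < y ^ (-(1 / 2 : ℝ)) ↔ y < 1 := by
  rw [Real.one_lt_rpow_iff_of_pos hy]
  constructor
  · rintro (h | h)
    · linarith [h.2]
    · exact h.1
  · exact fun h => Or.inr ⟨h, by norm_num⟩

/-- Cutting off with an indicator turns the power rule for Mellin transforms on `(0,∞)` into a
substitution between `(0,1)` and `(1,∞)`. -/
theorem cpow_smul_indicator_comp_rpow (w : ℝ) (s : ℂ) :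
    EqOn (fun y : ℝ => (y : ℂ) ^ (s - 1) •
        (Ioi (1 : ℝ)).indicator (fun u => ((Real.exp (-w * u) : ℝ) : ℂ)) (y ^ (-(1 / 2 : ℝ))))
      ((Ioo (0 : ℝ) 1).indicator
        fun y => (y : ℂ) ^ (s - 1) * Real.exp (-w * y ^ (-(1 / 2 : ℝ)))) (Ioi 0) := by
  intro y hy
  have h := one_lt_rpow_neg_half_iff hy
  by_cases h1 : y < 1
  · rw [indicator_of_mem (show y ∈ Ioo (0 : ℝ) 1 from ⟨hy, h1⟩)]
    beta_reduce
    rw [indicator_of_mem (mem_Ioi.2 (h.2 h1)), smul_eq_mul]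
  · rw [indicator_of_notMem (fun h' : y ∈ Ioo (0 : ℝ) 1 => h1 h'.2)]
    beta_reduce
    rw [indicator_of_notMem (s := Ioi (1 : ℝ)) (fun h' => h1 (h.1 h')), smul_zero]

theorem cpow_smul_indicator_Ioi_one (w : ℝ) (s : ℂ) :
    (fun u : ℝ => (u : ℂ) ^ (s - 1) •
        (Ioi (1 : ℝ)).indicator (fun u => ((Real.exp (-w * u) : ℝ) : ℂ)) u) =
      (Ioi (1 : ℝ)).indicator fun u => (u : ℂ) ^ (s - 1) * Real.exp (-w * u) := by
  ext u
  by_cases h : u ∈ Ioi (1 : ℝ) <;> simp [h]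

theorem integrableOn_cpow_mul_exp_rpow_neg_half {w : ℝ} (hw : 0 < w) (s : ℂ) :
    IntegrableOn (fun y : ℝ => (y : ℂ) ^ s * Real.exp (-w * y ^ (-(1 / 2 : ℝ)))) (Ioo 0 1) := by
  have h : MellinConvergent
      ((Ioi (1 : ℝ)).indicator fun u => ((Real.exp (-w * u) : ℝ) : ℂ))
      ((s + 1) / (-(1 / 2 : ℝ) : ℝ)) := by
    rw [MellinConvergent, cpow_smul_indicator_Ioi_one, IntegrableOn,
      integrable_indicator_iff measurableSet_Ioi, IntegrableOn, Measure.restrict_restrict_of_subset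
        (Ioi_subset_Ioi zero_le_one)]
    exact integrableOn_cpow_mul_exp_neg_mul_Ioi_one hw _
  rw [← MellinConvergent.comp_rpow (by norm_num), MellinConvergent,
    integrableOn_congr_fun (cpow_smul_indicator_comp_rpow w (s + 1)) measurableSet_Ioi,
    IntegrableOn, integrable_indicator_iff measurableSet_Ioo, IntegrableOn,
    Measure.restrict_restrict_of_subset Ioo_subset_Ioi_self, add_sub_cancel_right] at h
  exact h

theorem integral_cpow_mul_exp_rpow_neg_half (w : ℝ) (s : ℂ) :
    ∫ y in Ioo (0 : ℝ) 1, (y : ℂ) ^ (s - 1) * Real.exp (-w * y ^ (-(1 / 2 : ℝ))) =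
      2 * ∫ u in Ioi (1 : ℝ), (u : ℂ) ^ (-2 * s - 1) * Real.exp (-w * u) := by
  have h := mellin_comp_rpow ((Ioi (1 : ℝ)).indicator fun u => ((Real.exp (-w * u) : ℝ) : ℂ)) s
    (-(1 / 2 : ℝ))
  rw [mellin, mellin, setIntegral_congr_fun measurableSet_Ioi (cpow_smul_indicator_comp_rpow w s),
    cpow_smul_indicator_Ioi_one, setIntegral_indicator measurableSet_Ioo,
    setIntegral_indicator measurableSet_Ioi, inter_eq_right.2 Ioo_subset_Ioi_self,
    inter_eq_right.2 (Ioi_subset_Ioi zero_le_one),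
    show s / ((-(1 / 2 : ℝ) : ℝ) : ℂ) = -2 * s by push_cast; field_simp] at h
  rw [h, real_smul]
  norm_num

theorem integral_cpow_mul_exp_rpow_neg_half_eq {w : ℝ} (hw : 0 < w) {s : ℂ}
    (hs : ∀ m : ℤ, 2 * s + m ≠ 0) :
    ∫ y in Ioo (0 : ℝ) 1, (y : ℂ) ^ (s - 1) * Real.exp (-w * y ^ (-(1 / 2 : ℝ))) =
      2 * ((w : ℂ) ^ (2 * s) * Gamma (-2 * s)) +
        ∑' n : ℕ, (-(w : ℂ)) ^ n / (n.factorial : ℂ) / (s - n / 2) := by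
  have hs' : ∀ m : ℕ, -2 * s + m ≠ 0 := fun m h =>
    hs (-m) (by push_cast; linear_combination -h)
  rw [integral_cpow_mul_exp_rpow_neg_half, integral_Ioi_one_cpow_mul_exp hw hs', mul_sub,
    ← tsum_mul_left, sub_eq_add_neg, ← tsum_neg, show -(-2 * s) = 2 * s by ring]
  congr 1
  refine tsum_congr fun n => ?_
  rw [show -2 * s + n = -2 * (s - n / 2) by ring]
  have : s - n / 2 ≠ 0 := fun h => hs (-n) (by push_cast; linear_combination 2 * h)
  field_simp

/-! ### The double series. -/

/-- The integral of `y ^ ν (1 - y) ^ d exp(-w y ^ (-1/2))` over `(0, 1)`, as the sum of a series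
in powers `w ^ (2 ν + 2 + 2 k)` and a power series in `w`. -/
theorem integral_Ioo_eq_tsum_add_tsum {w d : ℝ} (hw : 0 < w) (hd : 0 < d) {ν : ℂ}
    (hν : ∀ m : ℤ, 2 * ν + m ≠ 0) :
    ∃ S₃ S : ℂ,
      HasSum (fun k : ℕ => (oneSubRpowCoeff d k : ℂ) *
        (2 * ((w : ℂ) ^ (2 * (ν + 1 + k)) * Gamma (-2 * (ν + 1 + k))))) S₃ ∧
      HasSum (fun n : ℕ => (-(w : ℂ)) ^ n / (n.factorial : ℂ) *
        (Gamma (ν + 1 - n / 2) * Gamma (d + 1) / Gamma (ν + 1 - n / 2 + d + 1))) S ∧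
      ∫ y in Ioo (0 : ℝ) 1, (y : ℂ) ^ ν * Real.exp (-w * y ^ (-(1 / 2 : ℝ))) *
        ((1 - y) ^ d : ℝ) = S₃ + S := by
  have hc : Summable fun k => ‖(oneSubRpowCoeff d k : ℂ)‖ := by
    simpa using summable_abs_oneSubRpowCoeff hd
  have he := summable_neg_pow_div_factorial w
  have hJ := hasSum_integral_mul_powerSeries hc (integrableOn_cpow_mul_exp_rpow_neg_half hw ν)
    (F := fun y => ((1 - y) ^ d : ℝ)) (fun y hy => by
      have := hasSum_oneSubRpowCoeff d (y := y) (by rw [abs_of_pos hy.1]; exact hy.2)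
      exact_mod_cast this)
  obtain ⟨δ, hδ, hbound⟩ := exists_pos_le_norm_add_intCast hν
  set T : ℕ × ℕ → ℂ := fun p => (oneSubRpowCoeff d p.1 : ℂ) *
    ((-(w : ℂ)) ^ p.2 / (p.2.factorial : ℂ) / (ν + 1 + p.1 - p.2 / 2)) with hT
  have hTs : Summable T := by
    refine Summable.of_norm_bounded ((hc.mul_of_nonneg he (fun _ => norm_nonneg _)
      (fun _ => norm_nonneg _)).mul_right (2 / δ)) fun p => ?_
    -- Twice the denominator is an integer translate of `2ν`, hence at least `δ` in norm.
    have h1 : δ / 2 ≤ ‖ν + 1 + p.1 - p.2 / 2‖ := by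
      have := hbound (2 + 2 * p.1 - p.2)
      rw [show 2 * ν + ((2 + 2 * p.1 - p.2 : ℤ) : ℂ) = 2 * (ν + 1 + p.1 - p.2 / 2) by
        push_cast; ring, norm_mul, norm_ofNat] at this
      linarith
    simp only [hT]
    rw [norm_mul, norm_div _ (ν + 1 + p.1 - p.2 / 2), mul_assoc]
    gcongr
    rw [div_eq_mul_inv, ← inv_div δ]
    gcongr
  have hI : ∀ k : ℕ, (oneSubRpowCoeff d k : ℂ) * ∫ y in Ioo (0 : ℝ) 1,
      (y : ℂ) ^ ν * Real.exp (-w * y ^ (-(1 / 2 : ℝ))) * (y : ℂ) ^ k =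
      (oneSubRpowCoeff d k : ℂ) * (2 * ((w : ℂ) ^ (2 * (ν + 1 + k)) * Gamma (-2 * (ν + 1 + k))))
        + ∑' n, T (k, n) := by
    intro k
    have h1 : ∫ y in Ioo (0 : ℝ) 1,
        (y : ℂ) ^ ν * Real.exp (-w * y ^ (-(1 / 2 : ℝ))) * (y : ℂ) ^ k =
        ∫ y in Ioo (0 : ℝ) 1, (y : ℂ) ^ (ν + 1 + k - 1) * Real.exp (-w * y ^ (-(1 / 2 : ℝ))) := by
      refine setIntegral_congr_fun measurableSet_Ioo fun y hy => ?_
      have hy0 : (y : ℂ) ≠ 0 := ofReal_ne_zero.2 hy.1.ne'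
      rw [show ν + 1 + k - 1 = ν + k by ring, cpow_add _ _ hy0, cpow_natCast]
      ring
    rw [h1, integral_cpow_mul_exp_rpow_neg_half_eq hw (fun m h => hν (2 + 2 * k + m) (by
      push_cast; linear_combination h)), mul_add, ← tsum_mul_left]
  have hT1 : HasSum (fun k => ∑' n, T (k, n)) (∑' p, T p) :=
    hTs.hasSum.prod_fiberwise fun k => (hTs.prod_factor k).hasSum
  -- The other order of summation: the inner sum over `k` will be a Beta value.
  have hT2 : HasSum (fun n => ∑' k, T (k, n)) (∑' p, T p) := by
    have hs : Summable (T ∘ Prod.swap) := (Equiv.prodComm ℕ ℕ).summable_iff.2 hTs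
    have h1 := hs.hasSum.prod_fiberwise fun n => (hs.prod_factor n).hasSum
    rwa [show ∑' p, (T ∘ Prod.swap) p = ∑' p, T p from (Equiv.prodComm ℕ ℕ).tsum_eq T] at h1
  simp_rw [hI] at hJ
  -- `S₃` is the integral minus the double sum, so the series of Gamma terms converges without an
  -- estimate of its own.
  refine ⟨_, ∑' p, T p, ?_, ?_, (sub_add_cancel _ _).symm⟩
  · exact (hJ.sub hT1).congr_fun fun k => (add_sub_cancel_right _ _).symm
  · refine hT2.congr_fun fun n => ?_
    rw [← tsum_oneSubRpowCoeff_div hd (s := ν + 1 - n / 2) (fun m h => hν (2 - n + 2 * m) (by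
      push_cast; linear_combination 2 * h)), ← tsum_mul_left]
    refine tsum_congr fun k => ?_
    simp only [hT]
    rw [show ν + 1 - n / 2 + k = ν + 1 + k - n / 2 by ring]
    ring

/-! ### Identification with the hypergeometric series. -/

theorem ascPochhammer_eval_half (r : ℕ) :
    (ascPochhammer ℂ r).eval (1 / 2) * (r.factorial * 4 ^ r) = (2 * r).factorial := by
  induction r with
  | zero => simp
  | succ r ih =>
    rw [ascPochhammer_succ_eval, show 2 * (r + 1) = 2 * r + 1 + 1 by ring, Nat.factorial_succ,
      Nat.factorial_succ, Nat.factorial_succ, pow_succ]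
    push_cast
    linear_combination (2 * r + 1 : ℂ) * (2 * r + 1 + 1) * ih

theorem ascPochhammer_eval_three_halves (r : ℕ) :
    (ascPochhammer ℂ r).eval (3 / 2) * (r.factorial * 4 ^ r) = (2 * r + 1).factorial := by
  induction r with
  | zero => simp
  | succ r ih =>
    rw [ascPochhammer_succ_eval, show 2 * (r + 1) + 1 = 2 * r + 1 + 1 + 1 by ring,
      Nat.factorial_succ, Nat.factorial_succ (2 * r + 1 + 1), Nat.factorial_succ (2 * r + 1),
      pow_succ]
    push_cast
    linear_combination (2 * r + 1 + 1 : ℂ) * (2 * r + 1 + 1 + 1) * ih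

/-- Used with `b = 1/2, m = 2r` and `b = 3/2, m = 2r+1`; since `w² = 4z`, `(4z)^r/m!` is what the
exponential series supplies. -/
theorem Gamma_div_mul_oneFTwoTerm' {p : ℂ} (hp : ∀ k : ℕ, p ≠ k + 1) (t b z : ℂ) (r m : ℕ)
    (hb : (ascPochhammer ℂ r).eval b * (r.factorial * 4 ^ r) = m.factorial) :
    Gamma p / Gamma t * oneFTwoTerm (1 - t) b (1 - p) z r =
      (4 * z) ^ r / (m.factorial : ℂ) * (Gamma (p - r) / Gamma (t - r)) := by
  rw [Gamma_sub_natCast hp, div_eq_mul_inv _ (Gamma (t - r)), inv_Gamma_sub_natCast, oneFTwoTerm,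
    ← hb]
  have h : ((-1 : ℂ) ^ r) * (-1) ^ r = 1 := by rw [← mul_pow]; simp
  have h4 : ((4 : ℂ) ^ r) * ((4 : ℂ) ^ r)⁻¹ = 1 := mul_inv_cancel₀ (by simp)
  simp only [div_eq_mul_inv, mul_inv, mul_pow]
  linear_combination (-(Gamma p * (Gamma t)⁻¹ * (ascPochhammer ℂ r).eval (1 - t)
    * ((ascPochhammer ℂ r).eval (1 - p))⁻¹ * ((ascPochhammer ℂ r).eval b)⁻¹ * z ^ r
    * (r.factorial : ℂ)⁻¹)) * (((-1 : ℂ) ^ r) * (-1) ^ r * h4 + h)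

theorem two_mul_sqrt_cpow {z : ℝ} (hz : 0 < z) (p : ℂ) :
    ((2 * Real.sqrt z : ℝ) : ℂ) ^ (2 * p) = 2 ^ (2 * p) * (z : ℂ) ^ p := by
  have h : (((Real.sqrt z : ℝ) : ℂ)) ^ (2 * p) = (z : ℂ) ^ p := by
    rw [two_mul, cpow_add _ _ (ofReal_ne_zero.2 (Real.sqrt_pos.2 hz).ne'),
      ← mul_cpow_ofReal_nonneg (Real.sqrt_nonneg z) (Real.sqrt_nonneg z), ← ofReal_mul,
      Real.mul_self_sqrt hz.le]
  rw [ofReal_mul, mul_cpow_ofReal_nonneg zero_le_two (Real.sqrt_nonneg z), h, ofReal_ofNat]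

/-- Legendre duplication at `-p`; its power of `2` cancels against `2 · 2^(2p)`. -/
theorem two_mul_cpow_mul_Gamma {z : ℝ} (hz : 0 < z) (p : ℂ) :
    2 * (((2 * Real.sqrt z : ℝ) : ℂ) ^ (2 * p) * Gamma (-2 * p)) =
      (z : ℂ) ^ p * (Gamma (-p) * Gamma (-p + 1 / 2)) / (Real.sqrt Real.pi : ℂ) := by
  have hpi : (Real.sqrt Real.pi : ℂ) ≠ 0 :=
    ofReal_ne_zero.2 (Real.sqrt_pos.2 Real.pi_pos).ne'
  rw [Gamma_mul_Gamma_add_half, two_mul_sqrt_cpow hz, show 1 - 2 * -p = 1 + 2 * p by ring,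
    cpow_add _ _ two_ne_zero, cpow_one, show 2 * -p = -2 * p by ring]
  field_simp

theorem integral_Ioo_eq_oneFTwo {z d : ℝ} (hz : 0 < z) (hd : 0 < d) {ν : ℂ}
    (hν : ∀ m : ℤ, 2 * ν + m ≠ 0) :
    ∫ y in Ioo (0 : ℝ) 1, (y : ℂ) ^ ν * Real.exp (-(2 * Real.sqrt z) * y ^ (-(1 / 2 : ℝ))) *
        ((1 - y) ^ d : ℝ) =
      Gamma (d + 1) / (Real.sqrt Real.pi : ℂ) *
        ((Real.sqrt Real.pi : ℂ) * Gamma (1 + ν) / Gamma (2 + ν + d)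
            * oneFTwo (-1 - ν - d) (1 / 2) (-ν) z
          + -(2 * (Real.sqrt Real.pi : ℂ) * Gamma (1 / 2 + ν) / Gamma (3 / 2 + ν + d)
              * (z : ℂ) ^ (1 / 2 : ℂ)) * oneFTwo (-1 / 2 - ν - d) (3 / 2) (1 / 2 - ν) z
          + Gamma (-ν - 1) * Gamma (-ν - 1 / 2) / Gamma (1 + (d : ℂ)) * (z : ℂ) ^ (1 + ν)
              * oneFTwo (-(d : ℂ)) (2 + ν) (3 / 2 + ν) z) := by
  have hw : 0 < 2 * Real.sqrt z := by positivity
  have hz0 : (z : ℂ) ≠ 0 := ofReal_ne_zero.2 hz.ne'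
  have hpi : (Real.sqrt Real.pi : ℂ) ≠ 0 :=
    ofReal_ne_zero.2 (Real.sqrt_pos.2 Real.pi_pos).ne'
  have hG : Gamma (1 + (d : ℂ)) ≠ 0 := Gamma_ne_zero_of_re_pos (by simp; linarith)
  obtain ⟨S₃, S, h3, hS, hI⟩ := integral_Ioo_eq_tsum_add_tsum hw hd hν
  have hsq : (-((2 * Real.sqrt z : ℝ) : ℂ)) ^ 2 = 4 * z := by
    rw [← ofReal_neg, ← ofReal_pow, neg_sq, mul_pow, Real.sq_sqrt hz.le]
    push_cast
    ring
  have hsqrt : (z : ℂ) ^ (1 / 2 : ℂ) = (Real.sqrt z : ℝ) := by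
    rw [Real.sqrt_eq_rpow, ofReal_cpow hz.le]
    norm_num
  have he : HasSum (fun r : ℕ => (-((2 * Real.sqrt z : ℝ) : ℂ)) ^ (2 * r) / ((2 * r).factorial : ℂ)
      * (Gamma (ν + 1 - (2 * r : ℕ) / 2) * Gamma (d + 1) / Gamma (ν + 1 - (2 * r : ℕ) / 2 + d + 1)))
      (Gamma (d + 1) * (Gamma (1 + ν) / Gamma (2 + ν + d))
        * oneFTwo (-1 - ν - d) (1 / 2) (-ν) z) := by
    refine ((summable_oneFTwoTerm _ _ _ _).hasSum.mul_left _).congr_fun fun r => ?_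
    have h := Gamma_div_mul_oneFTwoTerm' (p := 1 + ν) (fun k h => hν (-(2 * k)) (by
      push_cast; linear_combination 2 * h)) (2 + ν + d) (1 / 2) z r _ (ascPochhammer_eval_half r)
    rw [show 1 - (2 + ν + d) = -1 - ν - d by ring, show 1 - (1 + ν) = -ν by ring] at h
    rw [mul_assoc, h, pow_mul, hsq]
    push_cast
    rw [show ν + 1 - 2 * (r : ℂ) / 2 = 1 + ν - r by ring,
      show 1 + ν - r + d + 1 = 2 + ν + d - r by ring]
    ring
  have ho : HasSum (fun r : ℕ => (-((2 * Real.sqrt z : ℝ) : ℂ)) ^ (2 * r + 1)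
      / ((2 * r + 1).factorial : ℂ) * (Gamma (ν + 1 - (2 * r + 1 : ℕ) / 2) * Gamma (d + 1)
        / Gamma (ν + 1 - (2 * r + 1 : ℕ) / 2 + d + 1)))
      (-(2 * (z : ℂ) ^ (1 / 2 : ℂ)) * Gamma (d + 1) * (Gamma (1 / 2 + ν) / Gamma (3 / 2 + ν + d))
        * oneFTwo (-1 / 2 - ν - d) (3 / 2) (1 / 2 - ν) z) := by
    refine ((summable_oneFTwoTerm _ _ _ _).hasSum.mul_left _).congr_fun fun r => ?_
    have h := Gamma_div_mul_oneFTwoTerm' (p := 1 / 2 + ν) (fun k h => hν (-(2 * k) - 1) (by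
      push_cast; linear_combination 2 * h)) (3 / 2 + ν + d) (3 / 2) z r _
      (ascPochhammer_eval_three_halves r)
    rw [show 1 - (3 / 2 + ν + d) = -1 / 2 - ν - d by ring,
      show 1 - (1 / 2 + ν) = 1 / 2 - ν by ring] at h
    rw [mul_assoc, h, pow_succ, pow_mul, hsq, hsqrt]
    push_cast
    rw [show ν + 1 - (2 * (r : ℂ) + 1) / 2 = 1 / 2 + ν - r by ring,
      show 1 / 2 + ν - r + d + 1 = 3 / 2 + ν + d - r by ring]
    ring
  have h3' : HasSum (fun k : ℕ => (oneSubRpowCoeff d k : ℂ) *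
      (2 * (((2 * Real.sqrt z : ℝ) : ℂ) ^ (2 * (ν + 1 + k)) * Gamma (-2 * (ν + 1 + k)))))
      (1 / (Real.sqrt Real.pi : ℂ) * (z : ℂ) ^ (1 + ν) * (Gamma (-ν - 1) * Gamma (-ν - 1 / 2))
        * oneFTwo (-(d : ℂ)) (2 + ν) (3 / 2 + ν) z) := by
    refine ((summable_oneFTwoTerm _ _ _ _).hasSum.mul_left _).congr_fun fun r => ?_
    have h := Gamma_div_mul_oneFTwoTerm (p := -ν - 1) (q := -ν - 1 / 2) (fun k h => hν (2 * k + 4)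
      (by push_cast; linear_combination -2 * h)) (fun k h => hν (2 * k + 3)
      (by push_cast; linear_combination -2 * h)) (1 + d) z r
    rw [show 1 - (1 + (d : ℂ)) = -d by ring, show 1 - (-ν - 1) = 2 + ν by ring,
      show 1 - (-ν - 1 / 2) = 3 / 2 + ν by ring, div_eq_mul_inv _ (Gamma (1 + d - r)),
      inv_Gamma_sub_natCast, show 1 - (1 + (d : ℂ)) = -d by ring] at h
    have hsgn : ((-1 : ℂ) ^ r) * (-1) ^ r = 1 := by rw [← mul_pow]; simp
    -- Clearing the nonzero factor `Γ(1+d)` leaves the binomial coefficient `(-d)_r/r!`.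
    have h' : Gamma (-ν - 1) * Gamma (-ν - 1 / 2)
        * oneFTwoTerm (-(d : ℂ)) (2 + ν) (3 / 2 + ν) z r =
        Gamma (-ν - 1 - r) * Gamma (-ν - 1 / 2 - r)
          * ((ascPochhammer ℂ r).eval (-(d : ℂ)) / (r.factorial : ℂ)) * z ^ r := by
      have hGi : Gamma (1 + (d : ℂ)) * (Gamma (1 + (d : ℂ)))⁻¹ = 1 := mul_inv_cancel₀ hG
      simp only [div_eq_mul_inv] at h ⊢
      linear_combination Gamma (1 + (d : ℂ)) * h - Gamma (-ν - 1) * Gamma (-ν - 1 * 2⁻¹)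
        * oneFTwoTerm (-(d : ℂ)) (2 + ν) (3 * 2⁻¹ + ν) z r * hGi
        + (Gamma (-ν - 1 - r) * Gamma (-ν - 1 * 2⁻¹ - r) * (ascPochhammer ℂ r).eval (-(d : ℂ))
          * (r.factorial : ℂ)⁻¹ * z ^ r) * (((-1 : ℂ) ^ r) * (-1) ^ r * hGi + hsgn)
    have hc : (oneSubRpowCoeff d r : ℂ) =
        (ascPochhammer ℂ r).eval (-(d : ℂ)) / (r.factorial : ℂ) := by
      rw [oneSubRpowCoeff]
      push_cast
      rw [← ofReal_neg, ← ascPochhammer_map ofRealHom, Polynomial.eval_map,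
        ← ofRealHom_eq_coe (-d), Polynomial.eval₂_hom]
      rfl
    rw [mul_assoc _ (Gamma (-ν - 1) * Gamma (-ν - 1 / 2)), h', hc, two_mul_cpow_mul_Gamma hz,
      show ν + 1 + r = 1 + ν + r by ring, cpow_add _ _ hz0, cpow_natCast,
      show -(1 + ν + (r : ℂ)) = -ν - 1 - r by ring,
      show -ν - 1 - r + 1 / 2 = -ν - 1 / 2 - r by ring]
    ring
  -- Even powers of `w` form `R₁`, odd powers `R₂`.
  have hS' := hS.unique (HasSum.even_add_odd he ho)
  rw [hI, hS', h3.unique h3', add_comm (d : ℂ) 1]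
  field_simp
  ring

/-! ### The Mellin–Barnes integral. -/

theorem norm_Gamma_le {s : ℂ} (hs : 0 < s.re) : ‖Gamma s‖ ≤ Real.Gamma s.re := by
  rw [Gamma_eq_integral hs, Real.Gamma_eq_integral hs, GammaIntegral]
  refine (norm_integral_le_integral_norm _).trans_eq ?_
  refine setIntegral_congr_fun measurableSet_Ioi fun x hx => ?_
  rw [norm_mul, norm_cpow_eq_rpow_re_of_pos hx, norm_real, Real.norm_of_nonneg (Real.exp_nonneg _)]
  simp

theorem re_add_mul_I (c t : ℝ) : ((c : ℂ) + (t : ℂ) * I).re = c := by simp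

theorem continuous_Gamma_vertical {a : ℂ} {c : ℝ} (hc : 0 < a.re + c) :
    Continuous fun t : ℝ => Gamma (a + ((c : ℂ) + (t : ℂ) * I)) := by
  refine continuous_iff_continuousAt.2 fun t => ?_
  have h : ContinuousAt Gamma (a + ((c : ℂ) + (t : ℂ) * I)) := by
    refine (differentiableAt_Gamma _ fun m hm => ?_).continuousAt
    have := congrArg re hm
    simp at this
    linarith [(Nat.cast_nonneg m : (0 : ℝ) ≤ m)]
  exact ContinuousAt.comp (f := fun t : ℝ => a + ((c : ℂ) + (t : ℂ) * I)) h (by fun_prop)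

/-- Two steps of the functional equation, `Γ(s) = Γ(s+2)/(s(s+1))`, give quadratic decay, which
already suffices for integrability. -/
theorem norm_Gamma_vertical_le {c : ℝ} (hc : 0 < c) (t : ℝ) :
    ‖Gamma ((c : ℂ) + (t : ℂ) * I)‖ ≤ Real.Gamma (c + 2) * (min 1 (c ^ 2))⁻¹ * (1 + t ^ 2)⁻¹ := by
  set s : ℂ := (c : ℂ) + (t : ℂ) * I with hs
  have hre : s.re = c := re_add_mul_I c t
  have hs0 : s ≠ 0 := fun h => by rw [h] at hre; simp at hre; linarith
  have hs1 : s + 1 ≠ 0 := fun h => by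
    have := congrArg re h
    simp [hre] at this
    linarith
  have h1 : Gamma (s + 2) = (s + 1) * s * Gamma s := by
    rw [show s + 2 = s + 1 + 1 by ring, Gamma_add_one _ hs1, Gamma_add_one _ hs0]
    ring
  have h2 : ‖s‖ ^ 2 ≤ ‖(s + 1) * s‖ := by
    rw [norm_mul, sq]
    gcongr
    rw [norm_def, norm_def]
    apply Real.sqrt_le_sqrt
    simp [normSq_apply, hre]
    nlinarith
  have h3 : min 1 (c ^ 2) * (1 + t ^ 2) ≤ ‖s‖ ^ 2 := by
    rw [← normSq_eq_norm_sq, hs, normSq_add_mul_I]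
    have := min_le_left 1 (c ^ 2)
    have := min_le_right 1 (c ^ 2)
    nlinarith [sq_nonneg t]
  have h4 := norm_Gamma_le (s := s + 2) (by simp [hre]; linarith)
  rw [h1, norm_mul, show (s + 2).re = c + 2 by simp [hre]] at h4
  have h5 : 0 < min 1 (c ^ 2) := lt_min one_pos (by positivity)
  have h6 : (0 : ℝ) < 1 + t ^ 2 := by positivity
  rw [mul_assoc, ← mul_inv, ← div_eq_mul_inv, le_div_iff₀ (by positivity), mul_comm]
  exact (mul_le_mul_of_nonneg_right (h3.trans h2) (norm_nonneg _)).trans h4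

theorem integrable_Gamma_mul_Gamma_add_half {c : ℝ} (hc : 0 < c) :
    Integrable fun t : ℝ => Gamma ((c : ℂ) + (t : ℂ) * I) * Gamma (1 / 2 + ((c : ℂ) + (t : ℂ) * I)) := by
  have h1 : Continuous fun t : ℝ => Gamma ((c : ℂ) + (t : ℂ) * I) := by
    simpa using continuous_Gamma_vertical (a := 0) (c := c) (by simpa using hc)
  have h2 := continuous_Gamma_vertical (a := 1 / 2) (c := c) (by norm_num; linarith)
  refine Integrable.mul_bdd (c := Real.Gamma (1 / 2 + c)) ?_ h2.aestronglyMeasurable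
    (ae_of_all _ fun t => ?_)
  · exact (integrable_inv_one_add_sq.const_mul _).mono' h1.aestronglyMeasurable
      (ae_of_all _ (norm_Gamma_vertical_le hc))
  · have hre : (1 / 2 + ((c : ℂ) + (t : ℂ) * I)).re = 1 / 2 + c := by
      rw [add_re, re_add_mul_I]; norm_num
    simpa only [hre] using norm_Gamma_le (s := 1 / 2 + ((c : ℂ) + (t : ℂ) * I)) (by
      rw [hre]; linarith)

theorem hasMellin_exp_neg {s : ℂ} (hs : 0 < s.re) :
    HasMellin (fun t : ℝ => ((Real.exp (-t) : ℝ) : ℂ)) s (Gamma s) := by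
  refine ⟨?_, by rw [Gamma_eq_integral hs, GammaIntegral_eq_mellin]⟩
  have := GammaIntegral_convergent hs
  simp_rw [mul_comm] at this
  exact this

/-- From the Mellin transform of `exp(-x)` by scaling and the power rule; duplication then splits
`Γ(2s)`. -/
theorem hasMellin_exp_neg_two_mul_sqrt {s : ℂ} (hs : 0 < s.re) :
    HasMellin (fun x : ℝ => ((Real.exp (-(2 * x ^ (1 / 2 : ℝ))) : ℝ) : ℂ)) s
      (Gamma s * Gamma (1 / 2 + s) / (Real.sqrt Real.pi : ℂ)) := by
  have h2 : s / ((1 / 2 : ℝ) : ℂ) = 2 * s := by push_cast; field_simp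
  obtain ⟨h3, h4⟩ := hasMellin_exp_neg (s := 2 * s) (by simpa using hs)
  have hpi : (Real.sqrt Real.pi : ℂ) ≠ 0 :=
    ofReal_ne_zero.2 (Real.sqrt_pos.2 Real.pi_pos).ne'
  constructor
  · rw [MellinConvergent.comp_rpow (f := fun x : ℝ => ((Real.exp (-(2 * x)) : ℝ) : ℂ))
      (by norm_num), h2, MellinConvergent.comp_mul_left
        (f := fun x : ℝ => ((Real.exp (-x) : ℝ) : ℂ)) two_pos]
    exact h3
  · rw [mellin_comp_rpow (fun x : ℝ => ((Real.exp (-(2 * x)) : ℝ) : ℂ)), h2,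
      mellin_comp_mul_left (fun x : ℝ => ((Real.exp (-x) : ℝ) : ℂ)) _ two_pos, h4,
      add_comm (1 / 2 : ℂ), Gamma_mul_Gamma_add_half, show 1 - 2 * s = 1 + -(2 * s) by ring,
      cpow_add _ _ two_ne_zero, cpow_one, real_smul]
    norm_num
    field_simp

/-- The Mellin–Barnes representation of `exp (-2 √x)`. -/
theorem exp_neg_two_mul_sqrt_eq_integral {c x : ℝ} (hc : 0 < c) (hx : 0 < x) :
    ((Real.exp (-(2 * x ^ (1 / 2 : ℝ))) : ℝ) : ℂ) =
      1 / (2 * (Real.pi : ℂ)) / (Real.sqrt Real.pi : ℂ) *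
        ∫ t : ℝ, (x : ℂ) ^ (-((c : ℂ) + (t : ℂ) * I)) *
          (Gamma ((c : ℂ) + (t : ℂ) * I) * Gamma (1 / 2 + ((c : ℂ) + (t : ℂ) * I))) := by
  have hm : ∀ t : ℝ, mellin (fun x : ℝ => ((Real.exp (-(2 * x ^ (1 / 2 : ℝ))) : ℝ) : ℂ))
      ((c : ℂ) + (t : ℂ) * I) = Gamma ((c : ℂ) + (t : ℂ) * I)
        * Gamma (1 / 2 + ((c : ℂ) + (t : ℂ) * I)) / (Real.sqrt Real.pi : ℂ) := fun t =>
    (hasMellin_exp_neg_two_mul_sqrt (by rwa [re_add_mul_I])).2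
  have h := mellinInv_mellin_eq c (fun x : ℝ => ((Real.exp (-(2 * x ^ (1 / 2 : ℝ))) : ℝ) : ℂ)) hx
    (hasMellin_exp_neg_two_mul_sqrt (by simpa using hc)).1 ?_ ?_
  · rw [← h, mellinInv]
    simp_rw [hm, smul_eq_mul, ← mul_div_assoc, integral_div, real_smul]
    push_cast
    ring
  · rw [VerticalIntegrable]
    simp_rw [hm]
    exact (integrable_Gamma_mul_Gamma_add_half hc).div_const _
  · refine continuous_ofReal.continuousAt.comp (Real.continuous_exp.continuousAt.comp ?_)
    exact ((continuousAt_id.rpow_const (Or.inr (by norm_num))).const_mul 2).neg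

theorem meijerGIntegrand_eq (ν z s : ℂ) (d : ℝ) :
    meijerGIntegrand [] [ν + (d : ℂ) + 2] [0, 1 / 2, ν + 1] [] z s =
      Gamma s * Gamma (1 / 2 + s) * Gamma (ν + 1 + s) / Gamma (ν + d + 2 + s) * z ^ (-s) := by
  simp [meijerGIntegrand, mul_assoc]

theorem integral_cpow_mul_one_sub_rpow {d : ℝ} (hd : 0 < d) {p : ℂ} (hp : -1 < p.re) :
    ∫ y in Ioo (0 : ℝ) 1, (y : ℂ) ^ p * ((1 - y) ^ d : ℝ) =
      Gamma (d + 1) * (Gamma (p + 1) / Gamma (p + d + 2)) := by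
  have h := betaIntegral_eq_Gamma_mul_div (s := p + 1) (t := d + 1) (by simp; linarith)
    (by simp; linarith)
  rw [show Gamma (d + 1) * (Gamma (p + 1) / Gamma (p + d + 2)) =
    Gamma (p + 1) * Gamma (d + 1) / Gamma (p + 1 + (d + 1)) by
      rw [show p + 1 + (d + 1) = p + d + 2 by ring]; ring, ← h, betaIntegral,
    intervalIntegral.integral_of_le zero_le_one, integral_Ioc_eq_integral_Ioo]
  refine setIntegral_congr_fun measurableSet_Ioo fun y hy => ?_
  rw [ofReal_cpow (by linarith [hy.2])]
  simp

theorem integrableOn_cpow_mul_one_sub_rpow {d : ℝ} (hd : 0 < d) {p : ℂ} (hp : -1 < p.re) :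
    IntegrableOn (fun y : ℝ => (y : ℂ) ^ p * ((1 - y) ^ d : ℝ)) (Ioo 0 1) := by
  have h := integrableOn_cpow_Ioo (s := p + 1) (by simp; linarith)
  rw [add_sub_cancel_right] at h
  refine Integrable.mul_bdd (c := 1) h ((measurable_ofReal.comp
    ((measurable_const.sub measurable_id).pow_const d)).aestronglyMeasurable) ?_
  filter_upwards [ae_restrict_mem measurableSet_Ioo] with y hy
  have h1 : 0 ≤ 1 - y := by linarith [hy.2]
  rw [norm_real, Real.norm_of_nonneg (Real.rpow_nonneg h1 _)]
  exact Real.rpow_le_one h1 (by linarith [hy.1]) hd.le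

theorem ofReal_div_cpow_neg {z y : ℝ} (hz : 0 < z) (hy : 0 < y) (s : ℂ) :
    ((z / y : ℝ) : ℂ) ^ (-s) = (z : ℂ) ^ (-s) * (y : ℂ) ^ s := by
  rw [div_eq_mul_inv, ofReal_mul, mul_cpow_ofReal_nonneg hz.le (inv_nonneg.2 hy.le), ofReal_inv,
    inv_cpow _ _ (by rw [arg_ofReal_of_nonneg hy.le]; exact Real.pi_pos.ne), cpow_neg (y : ℂ),
    inv_inv]

theorem integrable_mellinBarnes_kernel {c d z : ℝ} {ν : ℂ} (hc : 0 < c) (hν : -1 - ν.re < c)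
    (hd : 0 < d) (hz : 0 < z) :
    Integrable (fun p : ℝ × ℝ => ((p.1 : ℂ) ^ ν * ((1 - p.1) ^ d : ℝ)) *
        (((z / p.1 : ℝ) : ℂ) ^ (-((c : ℂ) + (p.2 : ℂ) * I)) *
          (Gamma ((c : ℂ) + (p.2 : ℂ) * I) * Gamma (1 / 2 + ((c : ℂ) + (p.2 : ℂ) * I)))))
      ((volume.restrict (Ioo (0 : ℝ) 1)).prod volume) := by
  have hz0 : (z : ℂ) ≠ 0 := ofReal_ne_zero.2 hz.ne'
  have h1 := integrableOn_cpow_mul_one_sub_rpow hd (p := ν + c) (by simp; linarith)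
  have h2 : Integrable fun t : ℝ => (Gamma ((c : ℂ) + (t : ℂ) * I)
      * Gamma (1 / 2 + ((c : ℂ) + (t : ℂ) * I))) * (z : ℂ) ^ (-((c : ℂ) + (t : ℂ) * I)) := by
    refine (integrable_Gamma_mul_Gamma_add_half hc).mul_bdd (c := z ^ (-c)) ?_
      (ae_of_all _ fun t => ?_)
    · refine Continuous.aestronglyMeasurable (Continuous.const_cpow (by fun_prop) (Or.inl hz0))
    · rw [norm_cpow_eq_rpow_re_of_pos hz, neg_re, re_add_mul_I]
  -- On the line, `y^(ν+s) = y^(ν+c) y^(it)` and the last factor is unimodular, so the kernel is a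
  -- product of integrable functions of `y` and `t` up to a bounded factor.
  have h3 := (h1.mul_prod h2).mul_bdd (c := 1)
    (g := fun p : ℝ × ℝ => (p.1 : ℂ) ^ ((p.2 : ℂ) * I)) (by
      exact (Measurable.pow (by fun_prop) (by fun_prop)).aestronglyMeasurable) (by
      filter_upwards [Measure.quasiMeasurePreserving_fst.ae
        (ae_restrict_mem (measurableSet_Ioo (a := (0 : ℝ)) (b := 1)))] with p hp
      rw [norm_cpow_eq_rpow_re_of_pos hp.1]
      simp)
  refine h3.congr ?_
  filter_upwards [Measure.quasiMeasurePreserving_fst.ae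
    (ae_restrict_mem (measurableSet_Ioo (a := (0 : ℝ)) (b := 1)))] with p hp
  have hp0 : (p.1 : ℂ) ≠ 0 := ofReal_ne_zero.2 hp.1.ne'
  rw [ofReal_div_cpow_neg hz hp.1, cpow_add _ _ hp0, cpow_add _ _ hp0]
  ring

theorem mellinBarnes_integral_Ioo {c d z : ℝ} {ν : ℂ} (hc : 0 < c) (hν : -1 - ν.re < c)
    (hd : 0 < d) (hz : 0 < z) :
    Integrable (fun t : ℝ => meijerGIntegrand [] [ν + (d : ℂ) + 2] [0, 1 / 2, ν + 1] [] (z : ℂ)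
      ((c : ℂ) + (t : ℂ) * I)) ∧
    ∫ y in Ioo (0 : ℝ) 1, (y : ℂ) ^ ν * Real.exp (-(2 * Real.sqrt z) * y ^ (-(1 / 2 : ℝ))) *
        ((1 - y) ^ d : ℝ) =
      Gamma (d + 1) / (Real.sqrt Real.pi : ℂ) * verticalLineIntegral
        (meijerGIntegrand [] [ν + (d : ℂ) + 2] [0, 1 / 2, ν + 1] [] (z : ℂ)) c := by
  have hG : Gamma ((d : ℂ) + 1) ≠ 0 := Gamma_ne_zero_of_re_pos (by simp; linarith)
  have hint := integrable_mellinBarnes_kernel hc hν hd hz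
  have hinner : ∀ t : ℝ, ∫ y in Ioo (0 : ℝ) 1, ((y : ℂ) ^ ν * ((1 - y) ^ d : ℝ)) *
        (((z / y : ℝ) : ℂ) ^ (-((c : ℂ) + (t : ℂ) * I)) *
          (Gamma ((c : ℂ) + (t : ℂ) * I) * Gamma (1 / 2 + ((c : ℂ) + (t : ℂ) * I)))) =
      Gamma (d + 1) * meijerGIntegrand [] [ν + (d : ℂ) + 2] [0, 1 / 2, ν + 1] [] (z : ℂ)
        ((c : ℂ) + (t : ℂ) * I) := by
    intro t
    have h1 := integral_cpow_mul_one_sub_rpow hd (p := ν + ((c : ℂ) + (t : ℂ) * I)) (by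
      rw [add_re, re_add_mul_I]; linarith)
    rw [meijerGIntegrand_eq, show ν + 1 + ((c : ℂ) + (t : ℂ) * I) = ν + (c + t * I) + 1 by ring,
      show ν + d + 2 + ((c : ℂ) + (t : ℂ) * I) = ν + (c + t * I) + d + 2 by ring]
    rw [show Gamma (d + 1) * (Gamma (c + t * I) * Gamma (1 / 2 + (c + t * I))
        * Gamma (ν + (c + t * I) + 1) / Gamma (ν + (c + t * I) + d + 2)
        * (z : ℂ) ^ (-((c : ℂ) + t * I))) =
      Gamma (d + 1) * (Gamma (ν + (c + t * I) + 1) / Gamma (ν + (c + t * I) + d + 2)) *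
        (Gamma (c + t * I) * Gamma (1 / 2 + (c + t * I)) * (z : ℂ) ^ (-((c : ℂ) + t * I))) by ring,
      ← h1, ← integral_mul_const]
    refine setIntegral_congr_fun measurableSet_Ioo fun y hy => ?_
    have hy0 : (y : ℂ) ≠ 0 := ofReal_ne_zero.2 hy.1.ne'
    rw [ofReal_div_cpow_neg hz hy.1, cpow_add ν _ hy0]
    ring
  constructor
  -- Integrability along the line is a by-product of Fubini: the inner `y`-integral is `Γ(d+1)`
  -- times the integrand.
  · have h := hint.integral_prod_right.const_mul (Gamma ((d : ℂ) + 1))⁻¹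
    refine h.congr (ae_of_all _ fun t => ?_)
    beta_reduce
    rw [hinner, inv_mul_cancel_left₀ hG]
  · have hswap := integral_integral_swap (f := fun y t : ℝ => ((y : ℂ) ^ ν * ((1 - y) ^ d : ℝ)) *
        (((z / y : ℝ) : ℂ) ^ (-((c : ℂ) + (t : ℂ) * I)) *
          (Gamma ((c : ℂ) + (t : ℂ) * I) * Gamma (1 / 2 + ((c : ℂ) + (t : ℂ) * I))))) hint
    simp_rw [hinner, integral_const_mul] at hswap
    have h1 : ∫ y in Ioo (0 : ℝ) 1, (y : ℂ) ^ ν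
        * Real.exp (-(2 * Real.sqrt z) * y ^ (-(1 / 2 : ℝ))) * ((1 - y) ^ d : ℝ) =
        ∫ y in Ioo (0 : ℝ) 1, 1 / (2 * (Real.pi : ℂ)) / (Real.sqrt Real.pi : ℂ) *
          (((y : ℂ) ^ ν * ((1 - y) ^ d : ℝ)) * ∫ t : ℝ,
            (((z / y : ℝ) : ℂ) ^ (-((c : ℂ) + (t : ℂ) * I)) *
          (Gamma ((c : ℂ) + (t : ℂ) * I) * Gamma (1 / 2 + ((c : ℂ) + (t : ℂ) * I))))) := by
      refine setIntegral_congr_fun measurableSet_Ioo fun y hy => ?_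
      have h2 := exp_neg_two_mul_sqrt_eq_integral hc (div_pos hz hy.1)
      rw [Real.div_rpow hz.le hy.1.le, ← Real.sqrt_eq_rpow z, div_eq_mul_inv,
        ← Real.rpow_neg hy.1.le, ← mul_assoc, ← neg_mul] at h2
      rw [h2]
      ring
    have h2 : ∀ X : ℂ, 1 / (2 * (Real.pi : ℂ)) / (Real.sqrt Real.pi : ℂ) * (Gamma (d + 1) * X) =
        Gamma (d + 1) / (Real.sqrt Real.pi : ℂ) * (1 / (2 * (Real.pi : ℂ) * I) * (X * I)) := by
      intro X
      have := Real.pi_ne_zero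
      have := I_ne_zero
      field_simp
    rw [h1, integral_const_mul, hswap, verticalLineIntegral, integral_mul_const, h2]

/-! ### Rescaling `x = d y`. -/

theorem cutoffIntegrand_mul_left {ν : ℂ} {α b d z : ℝ} (hα : α < 1) (hb : 0 < b)
    (hd : d = 1 / (1 - α)) (hz : z = (1 - α) * b ^ 2 / 4) {y : ℝ} (hy : 0 < y) :
    cutoffIntegrand ν α b (d * y) = (d : ℂ) ^ ν *
      ((y : ℂ) ^ ν * Real.exp (-(2 * Real.sqrt z) * y ^ (-(1 / 2 : ℝ))) * ((1 - y) ^ d : ℝ)) := by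
  have ha : 0 < 1 - α := by linarith
  have hd0 : 0 < d := by rw [hd]; positivity
  have h1 : (1 - α) * (d * y) = y := by rw [hd]; field_simp
  have h2 : b * d ^ (-(1 / 2 : ℝ)) = 2 * Real.sqrt z := by
    rw [hd, one_div, Real.inv_rpow ha.le, Real.rpow_neg ha.le, inv_inv, ← Real.sqrt_eq_rpow,
      ← sq_eq_sq₀ (by positivity) (by positivity), mul_pow, mul_pow, Real.sq_sqrt ha.le,
      Real.sq_sqrt (by rw [hz]; positivity), hz]
    ring
  rw [cutoffIntegrand, h1, Real.mul_rpow hd0.le hy.le, ofReal_mul,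
    mul_cpow_ofReal_nonneg hd0.le hy.le, ← mul_assoc (-b), neg_mul b, h2, ← hd, ofReal_mul]
  ring

theorem intervalIntegrable_cutoffIntegrand {ν : ℂ} {α b d : ℝ} (hα : α < 1) (hb : 0 < b)
    (hd : d = 1 / (1 - α)) : IntervalIntegrable (cutoffIntegrand ν α b) volume 0 d := by
  have ha : 0 < 1 - α := by linarith
  have hd0 : 0 < d := by rw [hd]; positivity
  have hw : 0 < 2 * Real.sqrt ((1 - α) * b ^ 2 / 4) := by positivity
  have h1 : IntegrableOn (fun y : ℝ => (y : ℂ) ^ ν *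
      Real.exp (-(2 * Real.sqrt ((1 - α) * b ^ 2 / 4)) * y ^ (-(1 / 2 : ℝ))) *
        ((1 - y) ^ d : ℝ)) (Ioo 0 1) := by
    refine Integrable.mul_bdd (c := 1) (integrableOn_cpow_mul_exp_rpow_neg_half hw ν)
      ((measurable_ofReal.comp
        ((measurable_const.sub measurable_id).pow_const d)).aestronglyMeasurable) ?_
    filter_upwards [ae_restrict_mem measurableSet_Ioo] with y hy
    have h1 : 0 ≤ 1 - y := by linarith [hy.2]
    rw [norm_real, Real.norm_of_nonneg (Real.rpow_nonneg h1 _)]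
    exact Real.rpow_le_one h1 (by linarith [hy.1]) hd0.le
  have h2 : IntervalIntegrable (fun y => cutoffIntegrand ν α b (d * y)) volume (0 / d) (d / d) := by
    rw [zero_div, div_self hd0.ne', intervalIntegrable_iff_integrableOn_Ioc_of_le zero_le_one,
      integrableOn_Ioc_iff_integrableOn_Ioo]
    exact IntegrableOn.congr_fun (h1.const_mul ((d : ℂ) ^ ν))
      (fun y hy => (cutoffIntegrand_mul_left hα hb hd rfl hy.1).symm) measurableSet_Ioo
  exact (IntervalIntegrable.comp_mul_left_iff hd0.ne').1 h2

theorem integral_cutoffIntegrand {ν : ℂ} {α b d z : ℝ} (hα : α < 1) (hb : 0 < b)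
    (hd : d = 1 / (1 - α)) (hz : z = (1 - α) * b ^ 2 / 4) :
    ∫ x in (0 : ℝ)..d, cutoffIntegrand ν α b x = (((1 - α : ℝ) : ℂ) ^ (ν + 1))⁻¹ *
      ∫ y in Ioo (0 : ℝ) 1, (y : ℂ) ^ ν * Real.exp (-(2 * Real.sqrt z) * y ^ (-(1 / 2 : ℝ))) *
        ((1 - y) ^ d : ℝ) := by
  have ha : 0 < 1 - α := by linarith
  have hd0 : 0 < d := by rw [hd]; positivity
  have h := intervalIntegral.smul_integral_comp_mul_left (a := 0) (b := 1)
    (cutoffIntegrand ν α b) d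
  rw [mul_zero, mul_one] at h
  rw [← h, intervalIntegral.integral_of_le zero_le_one, integral_Ioc_eq_integral_Ioo,
    setIntegral_congr_fun measurableSet_Ioo
      (fun y hy => cutoffIntegrand_mul_left (ν := ν) hα hb hd hz hy.1), integral_const_mul,
    real_smul, ← mul_assoc]
  congr 1
  rw [← inv_cpow _ _ (by rw [arg_ofReal_of_nonneg ha.le]; exact Real.pi_pos.ne), ← ofReal_inv,
    ← one_div, ← hd, cpow_add _ _ (ofReal_ne_zero.2 hd0.ne'), cpow_one, mul_comm]

/-! ### Analyticity of the integrand and the main theorem. -/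

theorem analyticAt_Gamma_const_add {u s : ℂ} (h : ∀ m : ℕ, u + s ≠ -m) :
    AnalyticAt ℂ (fun s => Gamma (u + s)) s :=
  AnalyticAt.fun_comp (analyticAt_Gamma h) (by fun_prop)

theorem analyticAt_inv_Gamma_const_add (u s : ℂ) : AnalyticAt ℂ (fun s => (Gamma (u + s))⁻¹) s :=
  AnalyticAt.fun_comp (g := fun s => (Gamma s)⁻¹) (f := fun s => u + s)
    (differentiable_one_div_Gamma.analyticAt _) (by fun_prop)

theorem analyticAt_const_cpow_neg {z : ℂ} (hz : z ≠ 0) (s : ℂ) :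
    AnalyticAt ℂ (fun s => z ^ (-s)) s := by
  have h : Differentiable ℂ fun s : ℂ => z ^ (-s) := fun s =>
    (differentiableAt_id.neg).const_cpow (Or.inl hz)
  exact h.analyticAt s

theorem mainTheorem6 (ν : ℂ) (hν : ∀ l : ℕ, ν ≠ (l : ℂ) / 2 ∧ ν ≠ -((l : ℂ) / 2))
    (α b : ℝ) (hb : 0 < b) (hα : α < 1)
    (d : ℝ) (hd : d = 1 / (1 - α))
    (z : ℝ) (hz : z = (1 - α) * b ^ 2 / 4)
    -- the factor in front of the braces
    (K : ℂ) (hK : K = Complex.Gamma ((d : ℂ) + 1)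
      / ((Real.sqrt Real.pi : ℂ) * ((1 - α : ℝ) : ℂ) ^ (ν + 1)))
    -- the coefficients of the three hypergeometric series
    (A₁ A₂ A₃ : ℂ)
    (hA₁ : A₁ = (Real.sqrt Real.pi : ℂ) * Complex.Gamma (1 + ν) / Complex.Gamma (2 + ν + d))
    (hA₂ : A₂ = -(2 * (Real.sqrt Real.pi : ℂ) * Complex.Gamma (1 / 2 + ν)
      / Complex.Gamma (3 / 2 + ν + d) * (z : ℂ) ^ (1 / 2 : ℂ)))
    (hA₃ : A₃ = Complex.Gamma (-ν - 1) * Complex.Gamma (-ν - 1 / 2)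
      / Complex.Gamma (1 + (d : ℂ)) * (z : ℂ) ^ (1 + ν))
    -- the integrand of the function `G^{3,0}_{1,3}`
    (G : ℂ → ℂ)
    (hG : G = meijerGIntegrand [] [ν + (d : ℂ) + 2] [0, 1 / 2, ν + 1] [] (z : ℂ)) :
    -- the cut-off integral and the three series converge absolutely
    IntervalIntegrable (cutoffIntegrand ν α b) MeasureTheory.volume 0 d ∧
    Summable (oneFTwoTerm (-1 - ν - d) (1 / 2) (-ν) z) ∧
    Summable (oneFTwoTerm (-1 / 2 - ν - d) (3 / 2) (1 / 2 - ν) z) ∧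
    Summable (oneFTwoTerm (-(d : ℂ)) (2 + ν) (3 / 2 + ν) z) ∧
    -- the evaluation of the cut-off integral
    (∫ x in (0 : ℝ)..d, cutoffIntegrand ν α b x) =
      K * (A₁ * oneFTwo (-1 - ν - d) (1 / 2) (-ν) z
        + A₂ * oneFTwo (-1 / 2 - ν - d) (3 / 2) (1 / 2 - ν) z
        + A₃ * oneFTwo (-(d : ℂ)) (2 + ν) (3 / 2 + ν) z) ∧
    -- the Mellin–Barnes integral, along any vertical line to the right of all poles
    (∀ c : ℝ, 0 < c → -1 - ν.re < c →
      MeasureTheory.Integrable (fun t : ℝ => G ((c : ℂ) + (t : ℂ) * Complex.I)) ∧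
      (∫ x in (0 : ℝ)..d, cutoffIntegrand ν α b x) = K * verticalLineIntegral G c) ∧
    -- the singularities of its integrand, and the terms of the three series as its residues
    (∀ s : ℂ, (∀ r : ℕ, s ≠ -(r : ℂ) ∧ s ≠ -1 / 2 - (r : ℂ) ∧ s ≠ -ν - 1 - (r : ℂ)) →
      AnalyticAt ℂ G s) ∧
    (∀ r : ℕ,
      HasSimplePoleResidue G (-(r : ℂ)) (A₁ * oneFTwoTerm (-1 - ν - d) (1 / 2) (-ν) z r) ∧
      HasSimplePoleResidue G (-1 / 2 - (r : ℂ))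
        (A₂ * oneFTwoTerm (-1 / 2 - ν - d) (3 / 2) (1 / 2 - ν) z r) ∧
      HasSimplePoleResidue G (-ν - 1 - (r : ℂ))
        (A₃ * oneFTwoTerm (-(d : ℂ)) (2 + ν) (3 / 2 + ν) z r)) := by
  have ha : 0 < 1 - α := by linarith
  have hd0 : 0 < d := by rw [hd]; positivity
  have hz0 : 0 < z := by rw [hz]; positivity
  have hzC : (z : ℂ) ≠ 0 := ofReal_ne_zero.2 hz0.ne'
  have hν' : ∀ m : ℤ, 2 * ν + m ≠ 0 := by
    intro m h
    obtain ⟨l, rfl | rfl⟩ := m.eq_nat_or_neg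
    · exact (hν l).2 (by push_cast at h; linear_combination h / 2)
    · exact (hν l).1 (by push_cast at h; linear_combination h / 2)
  have hhalf : ∀ m : ℤ, (1 / 2 : ℂ) + m ≠ 0 := by
    intro m h
    have h2 : ((1 + 2 * m : ℤ) : ℂ) = 0 := by push_cast; linear_combination 2 * h
    have h3 : 1 + 2 * m = 0 := by exact_mod_cast h2
    omega
  have hpi : Gamma (1 / 2) = (Real.sqrt Real.pi : ℂ) := by
    rw [← Real.Gamma_one_half_eq, ← Gamma_ofReal]
    norm_num
  -- Source of the factor `-2√π` in `A₂`; `Γ(1/2)` accounts for `√π` in `A₁`.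
  have hpi' : Gamma (-1 / 2) = -2 * (Real.sqrt Real.pi : ℂ) := by
    have h := Gamma_add_one (-1 / 2) (by norm_num)
    rw [show (-1 / 2 : ℂ) + 1 = 1 / 2 by norm_num, hpi] at h
    linear_combination 2 * h
  have hint := integral_cutoffIntegrand (ν := ν) hα hb hd hz
  have hGs : ∀ s, G s = Gamma s * Gamma (1 / 2 + s) * Gamma (ν + 1 + s)
      / Gamma (ν + d + 2 + s) * (z : ℂ) ^ (-s) := fun s => by rw [hG, meijerGIntegrand_eq]
  have hr : ∀ s, AnalyticAt ℂ (fun s => (Gamma (ν + d + 2 + s))⁻¹ * (z : ℂ) ^ (-s)) s := fun s =>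
    (analyticAt_inv_Gamma_const_add _ s).mul (analyticAt_const_cpow_neg hzC s)
  refine ⟨intervalIntegrable_cutoffIntegrand hα hb hd, summable_oneFTwoTerm _ _ _ _,
    summable_oneFTwoTerm _ _ _ _, summable_oneFTwoTerm _ _ _ _, ?_, fun c hc hcν => ?_,
    fun s hs => ?_, fun r => ⟨?_, ?_, ?_⟩⟩
  · rw [hint, integral_Ioo_eq_oneFTwo hz0 hd0 hν', hK, hA₁, hA₂, hA₃, ← mul_assoc]
    congr 1
    rw [div_mul_eq_div_div, div_eq_mul_inv _ (((1 - α : ℝ) : ℂ) ^ (ν + 1)), mul_comm]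
  · have h := mellinBarnes_integral_Ioo hc hcν hd0 hz0
    rw [← hG] at h
    refine ⟨h.1, ?_⟩
    rw [hint, h.2, hK, ← mul_assoc]
    congr 1
    rw [div_mul_eq_div_div, div_eq_mul_inv _ (((1 - α : ℝ) : ℂ) ^ (ν + 1)), mul_comm]
  · rw [show G = fun s => Gamma (0 + s) * Gamma (1 / 2 + s) * Gamma (ν + 1 + s)
      * ((Gamma (ν + d + 2 + s))⁻¹ * (z : ℂ) ^ (-s)) by
        ext s; rw [hGs, zero_add, div_eq_mul_inv, mul_assoc _ (Gamma _)⁻¹]]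
    refine (((analyticAt_Gamma_const_add fun m h => (hs m).1 ?_).mul
      (analyticAt_Gamma_const_add fun m h => (hs m).2.1 ?_)).mul
      (analyticAt_Gamma_const_add fun m h => (hs m).2.2 ?_)).mul (hr s) <;> linear_combination h
  -- The three pole sequences are pairwise disjoint by `hhalf` and `hν'`, so the other two Gamma
  -- factors are analytic here; likewise in the next two cases.
  · have h := hasSimplePoleResidue_Gamma_mul (f := G) (u := 0) (s₀ := -(r : ℂ))
      (h := fun s => Gamma (1 / 2 + s) * Gamma (ν + 1 + s)
        * ((Gamma (ν + d + 2 + s))⁻¹ * (z : ℂ) ^ (-s))) r (by ring)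
      (fun s => by rw [hGs, zero_add]; ring)
      (((analyticAt_Gamma_const_add fun m h => hhalf (m - r) (by
        push_cast; linear_combination h)).mul (analyticAt_Gamma_const_add fun m h =>
          hν' (2 + 2 * m - 2 * r) (by push_cast; linear_combination 2 * h))).mul (hr _))
    convert h using 1
    have h1 := Gamma_div_mul_oneFTwoTerm (p := 1 / 2) (q := 1 + ν)
      (fun k h => hhalf (-k - 1) (by push_cast; linear_combination h))
      (fun k h => hν' (-2 * k) (by push_cast; linear_combination 2 * h)) (2 + ν + d) z r
    rw [show 1 - (2 + ν + d) = -1 - ν - d by ring, show 1 - (1 + ν) = -ν by ring,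
      show (1 : ℂ) - 1 / 2 = 1 / 2 by ring, hpi] at h1
    rw [hA₁, h1, neg_neg, cpow_natCast, show ν + 1 + -(r : ℂ) = 1 + ν - r by ring,
      show ν + d + 2 + -(r : ℂ) = 2 + ν + d - r by ring, ← sub_eq_add_neg (1 / 2 : ℂ)]
    ring
  · have h := hasSimplePoleResidue_Gamma_mul (f := G) (u := 1 / 2) (s₀ := -1 / 2 - (r : ℂ))
      (h := fun s => Gamma (0 + s) * Gamma (ν + 1 + s)
        * ((Gamma (ν + d + 2 + s))⁻¹ * (z : ℂ) ^ (-s))) r (by ring)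
      (fun s => by rw [hGs, zero_add]; ring)
      (((analyticAt_Gamma_const_add fun m h => hhalf (r - m) (by
        push_cast; linear_combination -h)).mul (analyticAt_Gamma_const_add fun m h =>
          hν' (1 + 2 * m - 2 * r) (by push_cast; linear_combination 2 * h))).mul (hr _))
    convert h using 1
    have h1 := Gamma_div_mul_oneFTwoTerm (p := -1 / 2) (q := 1 / 2 + ν)
      (fun k h => hhalf (k + 1) (by push_cast; linear_combination -h))
      (fun k h => hν' (-2 * k - 1) (by push_cast; linear_combination 2 * h)) (3 / 2 + ν + d) z r
    rw [show 1 - (3 / 2 + ν + d) = -1 / 2 - ν - d by ring,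
      show 1 - (1 / 2 + ν) = 1 / 2 - ν by ring, show (1 : ℂ) - -1 / 2 = 3 / 2 by ring, hpi'] at h1
    rw [hA₂, zero_add, show -(-1 / 2 - (r : ℂ)) = 1 / 2 + r by ring, cpow_add _ _ hzC,
      cpow_natCast, show ν + 1 + (-1 / 2 - (r : ℂ)) = 1 / 2 + ν - r by ring,
      show ν + d + 2 + (-1 / 2 - (r : ℂ)) = 3 / 2 + ν + d - r by ring]
    linear_combination (z : ℂ) ^ (1 / 2 : ℂ) * h1
  · have h := hasSimplePoleResidue_Gamma_mul (f := G) (u := ν + 1) (s₀ := -ν - 1 - (r : ℂ))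
      (h := fun s => Gamma (0 + s) * Gamma (1 / 2 + s)
        * ((Gamma (ν + d + 2 + s))⁻¹ * (z : ℂ) ^ (-s))) r (by ring)
      (fun s => by rw [hGs, zero_add]; ring)
      (((analyticAt_Gamma_const_add fun m h => hν' (2 + 2 * r - 2 * m) (by
        push_cast; linear_combination -2 * h)).mul (analyticAt_Gamma_const_add fun m h =>
          hν' (1 + 2 * r - 2 * m) (by push_cast; linear_combination -2 * h))).mul (hr _))
    convert h using 1
    have h1 := Gamma_div_mul_oneFTwoTerm (p := -ν - 1) (q := -ν - 1 / 2)
      (fun k h => hν' (4 + 2 * k) (by push_cast; linear_combination -2 * h))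
      (fun k h => hν' (3 + 2 * k) (by push_cast; linear_combination -2 * h)) (1 + d) z r
    rw [show 1 - (1 + (d : ℂ)) = -d by ring, show 1 - (-ν - 1) = 2 + ν by ring,
      show 1 - (-ν - 1 / 2) = 3 / 2 + ν by ring] at h1
    rw [hA₃, zero_add, show -(-ν - 1 - (r : ℂ)) = 1 + ν + r by ring, cpow_add (1 + ν) _ hzC,
      cpow_natCast, show 1 / 2 + (-ν - 1 - (r : ℂ)) = -ν - 1 / 2 - r by ring,
      show ν + d + 2 + (-ν - 1 - (r : ℂ)) = 1 + d - r by ring]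
    linear_combination (z : ℂ) ^ (1 + ν) * h1
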